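/- All graphs are finite and simple. A graph $G$ is $H$-free if no induced subgraph of $G$ is isomorphic to $H$. For a fixed graph $H$, an instance of $H$-free Edge Editing is a pair $(G,k)$ of a graph $G$ and an integer $k\ge 0$, and the question is whether there is a set $F$ of at most $k$ unordered pairs of distinct vertices of $G$ such that the graph $G\triangle F=(V(G),E(G)\triangle F)$ is $H$-free. In $H$-free Edge Deletion one requires moreover $F\subseteq E(G)$, and in $H$-free Edge Completion $F\cap E(G)=\emptyset$. The parameter is $k$. A linear parameterized reduction from a parameterized problem $A$ to a parameterized problem $B$ is a map, computable in time polynomial in the size of the instance (with the parameter written in unary), that takes every instance $(G',k)$ to an instance $(G,k')$ such that $(G',k)$ is a yes-instance of $A$ if and only if $(G,k')$ is a yes-instance of $B$, and $k'=O(k)$. **Lemma.** Let $H$ be a graph, let $d$ be an integer, let $V'$ be the set of vertices of $H$ of degree more than $d$, and let $H'=H[V']$ be the subgraph of $H$ induced by $V'$. Then, for each of the three kinds of modification (Editing, Deletion, Completion), there is a linear parameterized reduction from the $H'$-free problem of that kind to the $H$-free problem of the same kind. Moreover, the reduction can be chosen such that, for every instance $(G',k)$, its output graph $G$ is, up to isomorphism,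 obtained from $G'$ as follows. For every (not necessarily induced) subgraph $C$ of the complete graph on $V(G')$ that is isomorphic to $H'$, fix an isomorphism $\varphi_C\colon H'\to C$ and add $k+1$ disjoint sets of new vertices, each of them a copy of $V(H)\setminus V'$. For each such set $V_i$, add the edges within $V_i$ and between $V_i$ and $V(C)$ that correspond to the edges of $H$ with at least one end outside $V'$, where the vertices in $V'$ are identified with those of $C$ through $\varphi_C$. No other edges are added; in particular $G[V(G')]=G'$. -/

import Mathlib

open scoped symmDiff

/-! ### Edge modification problems -/

/-- `G` is `H`-free: no induced subgraph of `G` is isomorphic to `H`. -/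
def InducedFree {V W : Type*} (H : SimpleGraph V) (G : SimpleGraph W) : Prop :=
  ¬ H.IsIndContained G

/-- The three kinds of edge modification. -/
inductive ModificationKind
  | editing
  | deletion
  | completion

/-- The pairs of distinct vertices that may be modified: all of them for editing,
the edges for deletion, the non-edges for completion. -/
def ModificationKind.allowed {W : Type*} (G : SimpleGraph W) : ModificationKind → Set (Sym2 W)
  | editing => (⊤ : SimpleGraph W).edgeSet
  | deletion => G.edgeSet
  | completion => Gᶜ.edgeSet

/-- The graph `G ∆ F` with the vertices of `G` and edge set `E(G) ∆ F`. -/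
def modifyEdges {W : Type*} (G : SimpleGraph W) (F : Finset (Sym2 W)) : SimpleGraph W :=
  SimpleGraph.fromEdgeSet (G.edgeSet ∆ (F : Set (Sym2 W)))

/-- An instance `(G, k)` of a parameterized graph problem; the vertices of `G` are `0, …, n - 1`. -/
structure ParamGraph where
  n : ℕ
  graph : SimpleGraph (Fin n)
  k : ℕ

/-- The parameterized problem `H`-free Edge Editing / Deletion / Completion, as the set of its
yes-instances: at most `k` modifications of the given kind make `G` an `H`-free graph. -/
def FreeEdgeModification {V : Type*} (H : SimpleGraph V) (kind : ModificationKind) :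
    Set ParamGraph :=
  {I | ∃ F : Finset (Sym2 (Fin I.n)), (F : Set (Sym2 (Fin I.n))) ⊆ kind.allowed I.graph ∧
    F.card ≤ I.k ∧ InducedFree H (modifyEdges I.graph F)}

/-! ### Linear parameterized reductions -/

open Classical in
/-- The encoding of an instance as a word over the three letters `some true`, `some false`, `none`:
the parameter in unary, then the lower triangular adjacency matrix of the graph, where the row of
each vertex `v` is the separator `none` followed by the `v` bits that tell which of the vertices
`0, …, v - 1` are adjacent to `v`. -/
noncomputable def ParamGraph.encode (I : ParamGraph) : List (Option Bool) :=
  List.replicate I.k (some true) ++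
    (List.finRange I.n).flatMap fun v =>
      none :: ((List.finRange I.n).filter (fun u => u < v)).map
        fun u => some (decide (I.graph.Adj v u))

/-- `f` is a linear parameterized reduction from `A` to `B`: it is computed by a multi-stack Turing
machine in time polynomial in the length of the encoded instance, it maps exactly the yes-instances
of `A` to yes-instances of `B`, and the new parameter is `O(k)`. -/
def IsLinearParameterizedReduction (A B : Set ParamGraph) (f : ParamGraph → ParamGraph) : Prop :=
  Nonempty (Turing.TM2ComputableInPolyTime ParamGraph.encode ParamGraph.encode f) ∧
    (∀ I, I ∈ A ↔ f I ∈ B) ∧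
    ∃ c : ℕ, ∀ I, (f I).k ≤ c * I.k

/-! ### Attaching copies of a graph -/

/-- The copies of `H'` in the complete graph on `W`: all subgraphs (not necessarily induced) of
that complete graph that are isomorphic to `H'`. -/
def CopyInComplete {V : Type*} (H' : SimpleGraph V) (W : Type*) : Type _ :=
  {C : (⊤ : SimpleGraph W).Subgraph // Nonempty (H' ≃g C.coe)}

/-- Attach to `G'`, at every copy `C` of `H[S]` in the complete graph on the vertices of `G'`,
`r` copies of `H` that meet `G'` exactly in `C`: for each of them the vertices of `H` outside `S`
are new, and those in `S` are identified with the vertices of `C` through the isomorphism `φ C`.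
The edges within `V(G')` stay those of `G'`. -/
def attachCopies {V W : Type*} (H : SimpleGraph V) (S : Set V) (r : ℕ) (G' : SimpleGraph W)
    (φ : ∀ C : CopyInComplete (H.induce S) W, H.induce S ≃g C.1.coe) :
    SimpleGraph (W ⊕ (CopyInComplete (H.induce S) W × Fin r × ↥Sᶜ)) where
  Adj
    | .inl u, .inl v => G'.Adj u v
    | .inl u, .inr (C, _, x) => ∃ y : S, (φ C y : W) = u ∧ H.Adj y x
    | .inr (C, _, x), .inl u => ∃ y : S, (φ C y : W) = u ∧ H.Adj y x
    | .inr (C, i, x), .inr (D, j, y) => C = D ∧ i = j ∧ H.Adj x y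
  symm := ⟨by
    rintro (u | ⟨C, i, x⟩) (v | ⟨D, j, y⟩) h
    · exact SimpleGraph.Adj.symm h
    · exact h
    · exact h
    · exact ⟨h.1.symm, h.2.1.symm, SimpleGraph.Adj.symm h.2.2⟩⟩
  loopless := ⟨by
    rintro (u | ⟨C, i, x⟩) h
    · exact G'.loopless.irrefl u h
    · exact H.loopless.irrefl _ h.2.2⟩

/-! ### A structured language for stack machines -/

/-! Correctness. Let `F` solve the instance on `G'`, and suppose that `H` were induced in the
modified graph with attached copies. A new vertex keeps its neighbours, all of them inside its own
copy of `H`, so its degree is at most `d`. The vertices of `H` of degree more than `d` are therefore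
sent into `V(G')`, which exhibits an induced `H[V']` in the modified `G'`, a contradiction
(`CanModify.attachCopies`). Conversely, restrict a solution `F` with at most `k` pairs to `V(G')`.
An induced `H[V']` that survives there spans a copy `C` in the complete graph. To spoil one of the
`k + 1` copies of `H` at `C`, `F` must contain a pair with a new end in that copy, and such pairs
differ for different copies. So one copy is untouched and completes `C` to an induced `H`
(`CanModify.of_attachCopies`). Induced embeddings preserve edges and non-edges, so the argument is
the same for all three kinds of modification.

Computability. With `h = |V'|`, a copy of `H[V']` in the complete graph on `n` vertices is a set of
`h` vertices, written as a word of marks, together with one of the finitely many graphs on `Fin h`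
isomorphic to `H[V']` (`bijective_markedCopy`). If the new vertices are numbered after the old ones,
the encoding of the input is a prefix of that of the output, and only the rows of the new vertices
have to be appended (`exists_instance`). A stack program finds the sets by loops nested to the fixed
depth `h` and writes these rows in polynomial time (`exec_mainProg`,
`nonempty_computableInPolyTime`). Structured programs with a cost semantics are compiled to Turing
machines once and for all (`Exec.evalsToInTime`). -/

/-- Structured programs for machines with stacks indexed by `K` over the alphabet `Γ`.
The program `loop s c f` pops symbols `a` from the stack `s` and runs `f a`,
as long as the top of `s` is a symbol that satisfies `c`. -/
inductive StackProg (K Γ : Type) : Type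
  | skip : StackProg K Γ
  | push (s : K) (a : Γ) : StackProg K Γ
  | pop (s : K) : StackProg K Γ
  | seq (p q : StackProg K Γ) : StackProg K Γ
  | loop (s : K) (c : Γ → Bool) (f : Γ → StackProg K Γ) : StackProg K Γ

namespace StackProg

variable {K Γ : Type}

/-- The labels of the machine instructions of a program. -/
def Label : StackProg K Γ → Type
  | skip => Unit
  | push _ _ => Unit
  | pop _ => Unit
  | seq p q => Label p ⊕ Label q
  | loop _ _ f => Option (Σ a, Label (f a))

/-- The label of the first instruction. -/
def entry : (p : StackProg K Γ) → Label p
  | skip => ()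
  | push _ _ => ()
  | pop _ => ()
  | seq p _ => Sum.inl (entry p)
  | loop _ _ _ => none

@[reducible]
noncomputable def fintypeLabel [Fintype Γ] : (p : StackProg K Γ) → Fintype (Label p)
  | skip => inferInstanceAs (Fintype Unit)
  | push _ _ => inferInstanceAs (Fintype Unit)
  | pop _ => inferInstanceAs (Fintype Unit)
  | seq p q =>
    letI := fintypeLabel p
    letI := fintypeLabel q
    inferInstanceAs (Fintype (Label p ⊕ Label q))
  | loop _ _ f =>
    letI := fun a => fintypeLabel (f a)
    inferInstanceAs (Fintype (Option (Σ a, Label (f a))))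

/-- The machine instructions of a program whose labels are embedded by `e` and which continues
at `x`. -/
def code {Λ : Type} : (p : StackProg K Γ) → (Label p → Λ) → Λ → Label p →
    Turing.TM2.Stmt (fun _ : K => Γ) Λ (Option Γ)
  | skip, _, x, _ => .goto fun _ => x
  | push s a, _, x, _ => .push s (fun _ => a) (.goto fun _ => x)
  | pop s, _, x, _ => .pop s (fun v _ => v) (.goto fun _ => x)
  | seq p q, e, _, Sum.inl l => code p (fun l => e (Sum.inl l)) (e (Sum.inr (entry q))) l
  | seq _ q, e, x, Sum.inr l => code q (fun l => e (Sum.inr l)) x l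
  | loop s c f, e, x, none =>
    .peek s (fun _ o => o) <| .branch (fun v => v.any c)
      (.pop s (fun v _ => v) <| .goto fun v => match v with
        | some a => e (some ⟨a, entry (f a)⟩)
        | none => x)
      (.goto fun _ => x)
  | loop _ _ f, e, _, some ⟨a, l⟩ => code (f a) (fun l => e (some ⟨a, l⟩)) (e none) l

variable [DecidableEq K]

/-- `Exec p S S' t`: started with the stacks `S`, the program `p` ends with the stacks `S'` within
`t` steps. -/
inductive Exec : StackProg K Γ → (K → List Γ) → (K → List Γ) → ℕ → Prop
  | skip {S} : Exec skip S S 1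
  | push {s a S} : Exec (push s a) S (Function.update S s (a :: S s)) 1
  | pop {s S} : Exec (pop s) S (Function.update S s (S s).tail) 1
  | seq {p q S S' S'' t t'} : Exec p S S' t → Exec q S' S'' t' → Exec (seq p q) S S'' (t + t')
  | loop_exit {s c f S} : (∀ a ∈ (S s).head?, c a = false) → Exec (loop s c f) S S 1
  | loop_step {s c f S S' S'' a l t t'} : S s = a :: l → c a = true →
      Exec (f a) (Function.update S s l) S' t → Exec (loop s c f) S' S'' t' →
      Exec (loop s c f) S S'' (1 + t + t')
  | mono {p S S' t t'} : Exec p S S' t → t ≤ t' → Exec p S S' t'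

open StateTransition Turing

/-- The embedding `e` and the exit `x` are arbitrary so that the induction can place subprograms
inside a larger machine. The register may end with any value, because a loop overwrites it by
peeking before it branches. Peek, branch, pop and jump together form a single machine step. -/
theorem Exec.evalsToInTime {Λ : Type} (M : Λ → TM2.Stmt (fun _ : K => Γ) Λ (Option Γ))
    {p : StackProg K Γ} {S S' : K → List Γ} {t : ℕ} (h : Exec p S S' t) :
    ∀ (e : Label p → Λ) (x : Λ), (∀ l, M (e l) = code p e x l) → ∀ v, ∃ v',
      Nonempty (EvalsToInTime (TM2.step M) ⟨some (e (entry p)), v, S⟩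
        (some ⟨some x, v', S'⟩) t) := by
  induction h with
  | skip =>
    intro e x hM v
    refine ⟨v, ⟨⟨1, ?_⟩, le_rfl⟩⟩
    simp [flip, hM, code]
  | push =>
    intro e x hM v
    refine ⟨v, ⟨⟨1, ?_⟩, le_rfl⟩⟩
    simp [flip, hM, code]
  | pop =>
    intro e x hM v
    refine ⟨v, ⟨⟨1, ?_⟩, le_rfl⟩⟩
    simp [flip, hM, code]
  | @seq p q S S' S'' t t' _ _ ih₁ ih₂ =>
    intro e x hM v
    obtain ⟨v₁, ⟨h₁⟩⟩ := ih₁ (fun l => e (Sum.inl l)) (e (Sum.inr (entry q)))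
      (fun l => hM (Sum.inl l)) v
    obtain ⟨v₂, ⟨h₂⟩⟩ := ih₂ (fun l => e (Sum.inr l)) x (fun l => hM (Sum.inr l)) v₁
    rw [add_comm]
    exact ⟨v₂, ⟨EvalsToInTime.trans _ _ _ _ _ _ h₁ h₂⟩⟩
  | @loop_exit s c f S hS =>
    intro e x hM v
    refine ⟨(S s).head?, ⟨⟨1, ?_⟩, le_rfl⟩⟩
    have : (S s).head?.any c = false := by
      cases h : (S s).head? with
      | none => rfl
      | some a => exact hS a (by simp [h])
    simp [flip, entry, show M (e none) = _ from hM none, code, this]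
  | @loop_step s c f S S' S'' a l t t' hS ha _ _ ih₁ ih₂ =>
    intro e x hM v
    have h₀ : EvalsToInTime (TM2.step M) ⟨some (e (entry (loop s c f))), v, S⟩
        (some ⟨some (e (some ⟨a, entry (f a)⟩)), some a, Function.update S s l⟩) 1 := by
      refine ⟨⟨1, ?_⟩, le_rfl⟩
      simp [flip, entry, show M (e none) = _ from hM none, code, hS, ha]
    obtain ⟨v₁, ⟨h₁⟩⟩ := ih₁ (fun l => e (some ⟨a, l⟩)) (e none)
      (fun l => hM (some ⟨a, l⟩)) (some a)
    obtain ⟨v₂, ⟨h₂⟩⟩ := ih₂ e x hM v₁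
    have h := EvalsToInTime.trans _ _ _ _ _ _ h₀ (EvalsToInTime.trans _ _ _ _ _ _ h₁ h₂)
    exact ⟨v₂, ⟨⟨h.toEvalsTo, h.steps_le_m.trans (by omega)⟩⟩⟩
  | mono _ hle ih =>
    intro e x hM v
    obtain ⟨v', ⟨h⟩⟩ := ih e x hM v
    exact ⟨v', ⟨⟨h.toEvalsTo, h.steps_le_m.trans hle⟩⟩⟩

/-- The machine that runs the program `p` with `s` as its input and output stack. -/
noncomputable def toFinTM2 [Fintype K] [Fintype Γ] (p : StackProg K Γ) (s : K) : FinTM2 where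
  K := K
  k₀ := s
  k₁ := s
  Γ := fun _ => Γ
  Λ := Option (Label p)
  main := some (entry p)
  ΛFin := letI := fintypeLabel p; inferInstance
  σ := Option Γ
  initialState := none
  Γk₀Fin := inferInstanceAs (Fintype Γ)
  m
    | none => .load (fun _ => none) .halt
    | some l => code p some none l

theorem outputsInTime_toFinTM2 [Fintype K] [Fintype Γ] {p : StackProg K Γ} {s : K}
    {w w' : List Γ} {t : ℕ}
    (h : Exec p (Function.update (fun _ => []) s w) (Function.update (fun _ => []) s w') t) :
    Nonempty (TM2OutputsInTime (p.toFinTM2 s) w (some w') (t + 1)) := by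
  have stk_eq : ∀ u : List Γ, (fun k : K => dite (k = s) (fun _ => u) fun _ => []) =
      Function.update (fun _ : K => ([] : List Γ)) s u := by
    intro u
    funext k
    by_cases hk : k = s <;> simp [hk]
  obtain ⟨v, ⟨h₁⟩⟩ := h.evalsToInTime (p.toFinTM2 s).m some none (fun l => rfl) none
  rw [← stk_eq w, ← stk_eq w'] at h₁
  -- The additional step: the label `none` resets the register, as the prescribed halting
  -- configuration requires.
  have h₂ : EvalsToInTime (TM2.step (p.toFinTM2 s).m)
      ⟨some none, v, fun k : K => dite (k = s) (fun _ => w') fun _ => []⟩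
      (some (haltList (p.toFinTM2 s) w')) 1 := ⟨⟨1, rfl⟩, le_rfl⟩
  have h₃ := EvalsToInTime.trans _ _ _ _ _ _ h₁ h₂
  rw [add_comm] at h₃
  exact ⟨h₃⟩

end StackProg

/-! ### Basic stack programs and amortized running time -/

namespace StackProg

section Basic

variable {K Γ : Type} [DecidableEq K]

theorem Exec.congr {p : StackProg K Γ} {S S' S'' : K → List Γ} {t t' : ℕ} (h : Exec p S S' t)
    (hS : S' = S'') (ht : t ≤ t') : Exec p S S'' t' :=
  hS ▸ h.mono ht

theorem Exec.push_of {s : K} {a : Γ} {S S' : K → List Γ} (h : Function.update S s (a :: S s) = S') :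
    Exec (StackProg.push s a) S S' 1 := h ▸ .push

/-- Move the symbols that satisfy `c` from the top of `s` to `t`. -/
def move (s t : K) (c : Γ → Bool) : StackProg K Γ := loop s c fun x => push t x

/-- Move the symbols that satisfy `c` from the top of `s` to `t`, and push `y x` onto `o` for each
such symbol `x`. -/
def scan (s t o : K) (c : Γ → Bool) (y : Γ → Γ) : StackProg K Γ :=
  loop s c fun x => seq (push t x) (push o (y x))

/-- Empty the stack `s`. -/
def clear (s : K) : StackProg K Γ := loop s (fun _ => true) fun _ => skip

/-- Moving symbols one by one reverses them; the loop stops at `r` because its first symbol, if any,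
fails the test. -/
theorem exec_move {s t : K} (hst : s ≠ t) {c : Γ → Bool} {r : List Γ}
    (hr : ∀ x ∈ r.head?, c x = false) (l : List Γ) :
    ∀ S : K → List Γ, S s = l ++ r → (∀ x ∈ l, c x = true) →
      Exec (move s t c) S
        (Function.update (Function.update S s r) t (l.reverse ++ S t)) (2 * l.length + 1) := by
  induction l with
  | nil =>
    intro S hS _
    refine (Exec.loop_exit (by simpa [hS] using hr)).congr ?_ (by simp)
    funext k
    by_cases h₁ : k = t <;> by_cases h₂ : k = s <;> simp_all
  | cons x l ih =>
    intro S hS hc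
    refine (Exec.loop_step hS (hc x (by simp)) Exec.push
      (ih _ ?_ fun y hy => hc y (by simp [hy]))).congr ?_ (by simp; omega)
    · simp [Function.update_of_ne hst]
    · funext k
      by_cases h₁ : k = t <;> by_cases h₂ : k = s <;> simp_all

theorem exec_scan {s t o : K} (hst : s ≠ t) (hso : s ≠ o) (hto : t ≠ o) {c : Γ → Bool}
    {y : Γ → Γ} {r : List Γ} (hr : ∀ x ∈ r.head?, c x = false) (l : List Γ) :
    ∀ S : K → List Γ, S s = l ++ r → (∀ x ∈ l, c x = true) →
      Exec (scan s t o c y) S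
        (Function.update (Function.update (Function.update S s r) t (l.reverse ++ S t)) o
          ((l.map y).reverse ++ S o)) (3 * l.length + 1) := by
  induction l with
  | nil =>
    intro S hS _
    refine (Exec.loop_exit (by simpa [hS] using hr)).congr ?_ (by simp)
    funext k
    by_cases h₁ : k = t <;> by_cases h₂ : k = s <;> by_cases h₃ : k = o <;> simp_all
  | cons x l ih =>
    intro S hS hc
    refine (Exec.loop_step hS (hc x (by simp)) (Exec.seq Exec.push Exec.push)
      (ih _ ?_ fun y hy => hc y (by simp [hy]))).congr ?_ (by simp; omega)
    · simp [Function.update_of_ne hst, Function.update_of_ne hso]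
    · funext k
      by_cases h₁ : k = t <;> by_cases h₂ : k = s <;> by_cases h₃ : k = o <;>
        simp_all [Function.update_of_ne hto.symm]

theorem exec_clear {s : K} (l : List Γ) : ∀ S : K → List Γ, S s = l →
    Exec (clear s) S (Function.update S s []) (2 * l.length + 1) := by
  induction l with
  | nil =>
    intro S hS
    exact (Exec.loop_exit (by simp [hS])).congr (by simp [← hS]) (by simp)
  | cons x l ih =>
    intro S hS
    refine (Exec.loop_step hS rfl Exec.skip (ih _ (by simp))).congr ?_ (by simp; omega)
    simp

/-- The program `p` leads from `S` to `S'` in amortized time `T`, where the potential changes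
from `φ` to `φ'`. -/
def RunsWithin (p : StackProg K Γ) (S S' : K → List Γ) (T φ φ' : ℕ) : Prop :=
  ∃ t, Exec p S S' t ∧ t + φ ≤ T + φ'

theorem Exec.runsWithin {p : StackProg K Γ} {S S' : K → List Γ} {t : ℕ} (h : Exec p S S' t)
    (φ : ℕ) : RunsWithin p S S' t φ φ := ⟨t, h, le_rfl⟩

theorem RunsWithin.seq {p q : StackProg K Γ} {S S' S'' : K → List Γ} {T T' φ φ' φ'' : ℕ}
    (h : RunsWithin p S S' T φ φ') (h' : RunsWithin q S' S'' T' φ' φ'') :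
    RunsWithin (seq p q) S S'' (T + T') φ φ'' := by
  obtain ⟨t, ht, hle⟩ := h
  obtain ⟨t', ht', hle'⟩ := h'
  exact ⟨t + t', ht.seq ht', by omega⟩

theorem RunsWithin.loop_step {s : K} {c : Γ → Bool} {f : Γ → StackProg K Γ}
    {S S' S'' : K → List Γ} {T T' φ φ' φ'' : ℕ} {a : Γ} {l : List Γ} (hS : S s = a :: l)
    (ha : c a = true) (h : RunsWithin (f a) (Function.update S s l) S' T φ φ')
    (h' : RunsWithin (loop s c f) S' S'' T' φ' φ'') :
    RunsWithin (loop s c f) S S'' (1 + T + T') φ φ'' := by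
  obtain ⟨t, ht, hle⟩ := h
  obtain ⟨t', ht', hle'⟩ := h'
  exact ⟨1 + t + t', .loop_step hS ha ht ht', by omega⟩

theorem RunsWithin.mono {p : StackProg K Γ} {S S' : K → List Γ} {T T' φ φ' : ℕ}
    (h : RunsWithin p S S' T φ φ') (hT : T ≤ T') : RunsWithin p S S' T' φ φ' := by
  obtain ⟨t, ht, hle⟩ := h
  exact ⟨t, ht, by omega⟩

theorem RunsWithin.congr {p : StackProg K Γ} {S S' S'' : K → List Γ} {T T' φ φ' φ'' : ℕ}
    (h : RunsWithin p S S' T φ φ') (hS : S' = S'') (hφ : φ' = φ'') (hT : T ≤ T') :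
    RunsWithin p S S'' T' φ φ'' := by
  subst hS hφ
  exact h.mono hT

end Basic

end StackProg

/-! ### The stacks of the machine -/

namespace AttachMachine

open StackProg

/-- The stacks of the machine that attaches copies. -/
inductive Stk
  | inp | out | a | b | k | k' | p | p'

instance : DecidableEq Stk := fun s t => by
  cases s <;> cases t <;> first | exact isTrue rfl | exact isFalse nofun

instance : Fintype Stk where
  elems := {.inp, .out, .a, .b, .k, .k', .p, .p'}
  complete s := by cases s <;> decide

/-- The configuration with given stack contents. -/
def conf (i o a b k k' p p' : List (Option Bool)) : Stk → List (Option Bool)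
  | .inp => i
  | .out => o
  | .a => a
  | .b => b
  | .k => k
  | .k' => k'
  | .p => p
  | .p' => p'

section conf

variable (i o a b k k' p p' l : List (Option Bool))

@[simp] theorem conf_inp : conf i o a b k k' p p' .inp = i := rfl
@[simp] theorem conf_out : conf i o a b k k' p p' .out = o := rfl
@[simp] theorem conf_a : conf i o a b k k' p p' .a = a := rfl
@[simp] theorem conf_b : conf i o a b k k' p p' .b = b := rfl
@[simp] theorem conf_k : conf i o a b k k' p p' .k = k := rfl
@[simp] theorem conf_k' : conf i o a b k k' p p' .k' = k' := rfl
@[simp] theorem conf_p : conf i o a b k k' p p' .p = p := rfl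
@[simp] theorem conf_p' : conf i o a b k k' p p' .p' = p' := rfl

@[simp] theorem update_inp : Function.update (conf i o a b k k' p p') .inp l =
    conf l o a b k k' p p' := by funext s; cases s <;> rfl
@[simp] theorem update_out : Function.update (conf i o a b k k' p p') .out l =
    conf i l a b k k' p p' := by funext s; cases s <;> rfl
@[simp] theorem update_a : Function.update (conf i o a b k k' p p') .a l =
    conf i o l b k k' p p' := by funext s; cases s <;> rfl
@[simp] theorem update_b : Function.update (conf i o a b k k' p p') .b l =
    conf i o a l k k' p p' := by funext s; cases s <;> rfl
@[simp] theorem update_k : Function.update (conf i o a b k k' p p') .k l =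
    conf i o a b l k' p p' := by funext s; cases s <;> rfl
@[simp] theorem update_k' : Function.update (conf i o a b k k' p p') .k' l =
    conf i o a b k l p p' := by funext s; cases s <;> rfl
@[simp] theorem update_p : Function.update (conf i o a b k k' p p') .p l =
    conf i o a b k k' l p' := by funext s; cases s <;> rfl
@[simp] theorem update_p' : Function.update (conf i o a b k k' p p') .p' l =
    conf i o a b k k' p l := by funext s; cases s <;> rfl

theorem update_nil_inp :
    Function.update (fun _ => []) Stk.inp l = conf l [] [] [] [] [] [] [] := by
  funext s; cases s <;> rfl

end conf

/-! ### Distributing bits over the marks of a word -/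

/-- Replace the successive marks of a word by the bits of a list. -/
def bits : List Bool → List Bool → List Bool
  | _, [] => []
  | bs, false :: w => false :: bits bs w
  | c :: bs, true :: w => c :: bits bs w
  | [], true :: w => false :: bits [] w

@[simp] theorem length_bits (bs w : List Bool) : (bits bs w).length = w.length := by
  induction w generalizing bs with
  | nil => simp [bits]
  | cons c w ih => cases c <;> cases bs <;> simp [bits, ih]

theorem bits_replicate_false (bs : List Bool) (m : ℕ) :
    bits bs (List.replicate m false) = List.replicate m false := by
  induction m with
  | zero => simp [bits]
  | succ m ih => simp [List.replicate_succ, bits, ih]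

theorem bits_replicate_append (c : Bool) (bs w : List Bool) (m : ℕ) :
    bits (c :: bs) (List.replicate m false ++ true :: w) =
      List.replicate m false ++ c :: bits bs w := by
  induction m with
  | zero => simp [bits]
  | succ m ih => simp [List.replicate_succ, bits, ih]

theorem eq_replicate_false_of_count {w : List Bool} (h : w.count true = 0) :
    w = List.replicate w.length false := by
  rw [List.eq_replicate_iff]
  refine ⟨rfl, fun c hc => ?_⟩
  cases c with
  | false => rfl
  | true => exact absurd hc (List.count_eq_zero.1 h)

theorem exists_eq_replicate_append {w : List Bool} {n : ℕ} (h : w.count true = n + 1) :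
    ∃ m w', w = List.replicate m false ++ true :: w' ∧ w'.count true = n := by
  induction w with
  | nil => simp at h
  | cons c w ih =>
    cases c with
    | true => exact ⟨0, w, rfl, by simpa using h⟩
    | false =>
      obtain ⟨m, w', hw, hn⟩ := ih (by simpa using h)
      exact ⟨m + 1, w', by simp [hw, List.replicate_succ], hn⟩

/-- Push the word `bits bs w` onto `out`, where `w` is the word on `a`, and move `w` to `b`. -/
def emitBits : List Bool → StackProg Stk (Option Bool)
  | [] => scan .a .b .out (fun _ => true) fun _ => some false
  | c :: bs => seq (scan .a .b .out (fun x => x != some true) fun _ => some false) <|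
      seq (pop .a) <| seq (push .b (some true)) <| seq (push .out (some c)) <| emitBits bs

/-- Each bit belongs to the next mark: a scan writes zeros for the unmarked stretch and stops at the
mark, whose bit is then written. After the last bit only unmarked symbols remain. -/
theorem exec_emitBits (bs : List Bool) : ∀ (w : List Bool) (i o b k k' p p' : List (Option Bool)),
    w.count true = bs.length → Exec (emitBits bs) (conf i o (w.map some) b k k' p p')
      (conf i (((bits bs w).map some).reverse ++ o) [] ((w.map some).reverse ++ b) k k' p p')
      (3 * w.length + bs.length + 1) := by
  induction bs with
  | nil =>
    intro w i o b k k' p p' hw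
    have hw' := eq_replicate_false_of_count hw
    refine (exec_scan (by decide) (by decide) (by decide) (r := []) (by simp) (w.map some) _
      (by simp) (by simp)).congr ?_ (by simp)
    rw [hw', bits_replicate_false]
    simp
  | cons c bs ih =>
    intro w i o b k k' p p' hw
    obtain ⟨m, w', rfl, hw'⟩ := exists_eq_replicate_append hw
    have h₀ : Exec (scan .a .b .out (fun x => x != some true) fun _ => some false)
        (conf i o ((List.replicate m false ++ true :: w').map some) b k k' p p') _ _ :=
      exec_scan (by decide) (by decide) (by decide) (r := some true :: w'.map some)
        (by simp) (List.replicate m (some false)) _ (by simp) (by simp)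
    refine (h₀.seq <|
      Exec.pop.seq <| Exec.push.seq <| (Exec.push_of ?_).seq <|
      ih w' i (some c :: (List.replicate m (some false) ++ o))
        (some true :: (List.replicate m (some false) ++ b)) k k' p p' hw').congr ?_ ?_
    · simp
    · simp [bits_replicate_append]
    · simp
      omega

end AttachMachine

/-! ### Writing the rows of the new vertices -/

namespace AttachMachine

open StackProg

/-- The finite data that determine the machine: every copy of the graph gives rise to a word of
marks with `h` marks and an element `r` of `R`; each of the `q` new vertices `x` attached to it has
the list of adjacencies `old r x` to the marked vertices, and the adjacencies `new x y` to the other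
new vertices. -/
structure Params where
  h : ℕ
  q : ℕ
  ρ : Type
  R : List ρ
  old : ρ → Fin q → List Bool
  new : Fin q → Fin q → Bool
  length_old : ∀ r x, (old r x).length = h

variable (D : Params)

/-- The row of the new vertex `x` in a group, when there are `c` vertices in previous groups. -/
def rowWord (w : List Bool) (r : D.ρ) (c : ℕ) (x : Fin D.q) : List (Option Bool) :=
  none :: (bits (D.old r x) w ++ List.replicate c false ++
    ((List.finRange D.q).filter (· < x)).map (D.new x)).map some

/-- A group of new vertices: a word of marks, an element of `R`, and the index of the copy. -/
abbrev Params.Group := List Bool × D.ρ × ℕ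

/-- The rows of the new vertices in a group, when there are `c` vertices in previous groups. -/
def groupWord (c : ℕ) (g : D.Group) : List (Option Bool) :=
  (List.finRange D.q).flatMap (rowWord D g.1 g.2.1 c)

/-- The rows of the new vertices in the groups of a list. -/
def groupsWord (G : List D.Group) : List (Option Bool) :=
  G.zipIdx.flatMap fun y => groupWord D (D.q * y.2) y.1

theorem groupsWord_concat (G : List D.Group) (g : D.Group) :
    groupsWord D (G ++ [g]) = groupsWord D G ++ groupWord D (D.q * G.length) g := by
  simp [groupsWord, List.zipIdx_append]

theorem length_rowWord_le (w : List Bool) (r : D.ρ) (c : ℕ) (x : Fin D.q) :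
    (rowWord D w r c x).length ≤ 1 + w.length + c + D.q := by
  have := List.length_filter_le (· < x) (List.finRange D.q)
  simp only [List.length_finRange] at this
  simp [rowWord]
  omega

theorem length_groupWord_le (c : ℕ) (g : D.Group) :
    (groupWord D c g).length ≤ D.q * (1 + g.1.length + c + D.q) := by
  rw [groupWord, List.length_flatMap]
  refine (List.sum_le_card_nsmul _ (1 + g.1.length + c + D.q) ?_).trans (by simp)
  simp only [List.mem_map, forall_exists_index, and_imp]
  rintro _ x - rfl
  exact length_rowWord_le D _ _ _ _

theorem length_groupsWord_le (n : ℕ) (G : List D.Group) (hG : ∀ g ∈ G, g.1.length = n) :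
    (groupsWord D G).length ≤ G.length * (D.q * (1 + n + D.q * G.length)) := by
  induction G using List.reverseRecOn with
  | nil => simp [groupsWord]
  | append_singleton G g ih =>
    rw [groupsWord_concat, List.length_append, List.length_append, List.length_singleton]
    have h₁ := ih fun g hg => hG g (by simp [hg])
    have h₂ := length_groupWord_le D (D.q * G.length) g
    rw [hG g (by simp)] at h₂
    nlinarith [Nat.zero_le (G.length * (D.q * D.q))]

/-- Push the bits of a list. -/
def pushBits : List Bool → StackProg Stk (Option Bool)
  | [] => skip
  | c :: l => seq (push .out (some c)) (pushBits l)

theorem exec_pushBits (l : List Bool) : ∀ i o a b k k' p p' : List (Option Bool),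
    Exec (pushBits l) (conf i o a b k k' p p') (conf i ((l.map some).reverse ++ o) a b k k' p p')
      (l.length + 1) := by
  induction l with
  | nil =>
    intro i o a b k k' p p'
    exact Exec.skip
  | cons c l ih =>
    intro i o a b k k' p p'
    exact ((Exec.push_of (by simp)).seq (ih i (some c :: o) a b k k' p p')).congr (by simp)
      (by simp; omega)

/-- Push `m` symbols `none` onto the stack `p`. -/
def pushCount : ℕ → StackProg Stk (Option Bool)
  | 0 => skip
  | m + 1 => seq (push .p none) (pushCount m)

theorem exec_pushCount (m : ℕ) : ∀ (i o a b k k' p' : List (Option Bool)) (c : ℕ),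
    Exec (pushCount m) (conf i o a b k k' (List.replicate c none) p')
      (conf i o a b k k' (List.replicate (c + m) none) p') (m + 1) := by
  induction m with
  | zero =>
    intro i o a b k k' p' c
    exact Exec.skip
  | succ m ih =>
    intro i o a b k k' p' c
    exact ((Exec.push_of (by simp [List.replicate_succ])).seq (ih i o a b k k' p' (c + 1))).congr
      (by rw [add_assoc, add_comm 1 m]) (by omega)

/-- Write the row of a new vertex. -/
def rowProg (r : D.ρ) (x : Fin D.q) : StackProg Stk (Option Bool) :=
  seq (push .out none) <| seq (emitBits (D.old r x)) <| seq (move .b .a fun _ => true) <|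
    seq (scan .p .p' .out (fun _ => true) fun _ => some false) <| seq (move .p' .p fun _ => true) <|
    pushBits (((List.finRange D.q).filter (· < x)).map (D.new x))

theorem exec_rowProg (r : D.ρ) (x : Fin D.q) (w : List Bool) (hw : w.count true = D.h)
    (i o k k' : List (Option Bool)) (c : ℕ) :
    Exec (rowProg D r x) (conf i o (w.map some) [] k k' (List.replicate c none) [])
      (conf i ((rowWord D w r c x).reverse ++ o) (w.map some) [] k k' (List.replicate c none) [])
      ((D.h + D.q + 6) * (1 + w.length + c)) := by
  have h₁ := exec_emitBits (D.old r x) w i (none :: o) [] k k' (List.replicate c none) []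
    (by rw [hw, D.length_old])
  have h₂ (o) : Exec (move .b .a fun _ => true)
      (conf i o [] ((w.map some).reverse ++ []) k k' (List.replicate c none) []) _ _ :=
    exec_move (by decide) (r := []) (by simp) (w.map some).reverse _ (by simp) (by simp)
  have h₃ (o) : Exec (scan .p .p' .out (fun _ => true) fun _ => some false)
      (conf i o (w.map some) [] k k' (List.replicate c none) []) _ _ :=
    exec_scan (by decide) (by decide) (by decide) (r := []) (by simp) (List.replicate c none) _
      (by simp) (by simp)
  have h₄ (o) : Exec (move .p' .p fun _ => true)
      (conf i o (w.map some) [] k k' [] (List.replicate c none)) _ _ :=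
    exec_move (by decide) (r := []) (by simp) (List.replicate c none) _ (by simp) (by simp)
  have h₅ (o) := exec_pushBits (((List.finRange D.q).filter (· < x)).map (D.new x)) i o
    (w.map some) [] k k' (List.replicate c none) []
  simp only [update_b, update_a, update_out, update_p, update_p', conf_a, conf_out, conf_p,
    conf_p', List.reverse_reverse, List.append_nil, List.reverse_replicate, List.map_replicate] at h₁ h₂ h₃ h₄ h₅
  refine (Exec.seq (Exec.push_of (by simp)) <| h₁.seq <| (h₂ _).seq <| (h₃ _).seq <|
    (h₄ _).seq (h₅ _)).congr ?_ ?_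
  · simp [rowWord]
  -- The costs add up to at most `5|w| + 5c + h + q + 6`, which the product dominates.
  · have := List.length_filter_le (· < x) (List.finRange D.q)
    simp only [List.length_finRange] at this
    simp only [List.length_map, List.length_reverse, List.length_replicate, D.length_old]
    nlinarith [Nat.zero_le ((D.h + D.q) * (w.length + c))]

/-- Write the rows of the new vertices of a list. -/
def rowsProg (r : D.ρ) : List (Fin D.q) → StackProg Stk (Option Bool)
  | [] => skip
  | x :: l => seq (rowProg D r x) (rowsProg r l)

theorem exec_rowsProg (r : D.ρ) (w : List Bool) (hw : w.count true = D.h) (l : List (Fin D.q)) :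
    ∀ (i o k k' : List (Option Bool)) (c : ℕ),
    Exec (rowsProg D r l) (conf i o (w.map some) [] k k' (List.replicate c none) [])
      (conf i ((l.flatMap (rowWord D w r c)).reverse ++ o) (w.map some) [] k k'
        (List.replicate c none) [])
      (l.length * ((D.h + D.q + 6) * (1 + w.length + c)) + 1) := by
  induction l with
  | nil =>
    intro i o k k' c
    exact Exec.skip.congr (by simp) (by simp)
  | cons x l ih =>
    intro i o k k' c
    exact ((exec_rowProg D r x w hw i o k k' c).seq (ih i _ k k' c)).congr (by simp)
      (by rw [List.length_cons]; linarith)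

/-- Write the rows of a group of new vertices. -/
def groupProg (r : D.ρ) : StackProg Stk (Option Bool) :=
  seq (rowsProg D r (List.finRange D.q)) (pushCount D.q)

/-- The potential after `m` groups, for graphs with `n` vertices. -/
def pot (n m : ℕ) : ℕ := (D.h + D.q + 6) * (D.q * m) * (1 + n + D.q * m)

/-- The configuration after the groups `G`, for an input with encoding `u`. -/
def state (u : List (Option Bool)) (G : List D.Group) (a b k k' : List (Option Bool)) :
    Stk → List (Option Bool) :=
  conf [] (u ++ groupsWord D G).reverse a b k k' (List.replicate (D.q * G.length) none) []

/-- A row contains a zero for every vertex of the earlier groups, so the cost of a group grows with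
their number. The increase of `pot` pays for this, and the amortized cost `q + 2` does not depend on
the history. The index `j` leaves no trace on the stacks; it only keeps the groups at one copy
distinct. -/
theorem runs_groupProg (u : List (Option Bool)) (w : List Bool) (hw : w.count true = D.h)
    (r : D.ρ) (j : ℕ) (G : List D.Group) (k k' : List (Option Bool)) :
    RunsWithin (groupProg D r) (state D u G (w.map some) [] k k')
      (state D u (G ++ [(w, r, j)]) (w.map some) [] k k') (D.q + 2)
      (pot D w.length G.length) (pot D w.length (G.length + 1)) := by
  refine ⟨_, ((exec_rowsProg D r w hw (List.finRange D.q) _ _ _ _ _).seq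
    (exec_pushCount D.q _ _ _ _ _ _ _ _)).congr ?_ le_rfl, ?_⟩
  · rw [state, groupsWord_concat]
    simp [groupWord, mul_add]
  · simp only [pot, List.length_finRange]
    nlinarith [Nat.zero_le ((D.h + D.q + 6) * (D.q * G.length) * D.q),
      Nat.zero_le ((D.h + D.q + 6) * D.q * D.q)]

/-- Write the rows of `k + 1` groups. -/
def copiesProg (r : D.ρ) : StackProg Stk (Option Bool) :=
  seq (groupProg D r) <|
    seq (loop .k (fun _ => true) fun x => seq (push .k' x) (groupProg D r)) <|
    move .k' .k fun _ => true

/-- The `k + 1` groups of a copy. -/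
def copyGroups (k : ℕ) (w : List Bool) (r : D.ρ) : List D.Group :=
  (List.range (k + 1)).map fun j => (w, r, j)

/-- The content of the stack that holds the parameter. -/
def unary (k : ℕ) : List (Option Bool) := List.replicate k (some true)

theorem runs_copiesLoop (u : List (Option Bool)) (w : List Bool) (hw : w.count true = D.h)
    (r : D.ρ) (m : ℕ) : ∀ (j : ℕ) (G : List D.Group),
    RunsWithin (loop .k (fun _ => true) fun x => seq (push .k' x) (groupProg D r))
      (state D u G (w.map some) [] (unary m) (unary j))
      (state D u (G ++ (List.range' (j + 1) m).map fun j => (w, r, j)) (w.map some) []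
        [] (unary (j + m))) (m * (D.q + 4) + 1)
      (pot D w.length G.length) (pot D w.length (G.length + m)) := by
  induction m with
  | zero =>
    intro j G
    exact ((Exec.loop_exit (by simp [state, unary])).congr (by simp [unary]) (by simp)).runsWithin _
  | succ m ih =>
    intro j G
    have h₁ := ih (j + 1) (G ++ [(w, r, j + 1)])
    have h₂ := runs_groupProg D u w hw r (j + 1) G (unary m) (unary (j + 1))
    have h₃ : Exec (push .k' (some true)) (state D u G (w.map some) [] (unary m) (unary j))
        (state D u G (w.map some) [] (unary m) (unary (j + 1))) 1 :=
      Exec.push_of (by simp [state, unary, List.replicate_succ])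
    simp only [List.length_append, List.length_singleton] at h₁
    have h₄ := RunsWithin.loop_step (s := .k) (c := fun _ => true)
      (f := fun x => seq (push .k' x) (groupProg D r))
      (S := state D u G (w.map some) [] (unary (m + 1)) (unary j)) (a := some true) (l := unary m)
      (by simp [state, unary, List.replicate_succ]) rfl
      (by simpa [state] using (h₃.runsWithin _).seq h₂) h₁
    convert h₄.mono (T' := (m + 1) * (D.q + 4) + 1) (by linarith) using 1
    · simp [List.range'_succ, add_assoc, add_comm 1 m]
    · rw [add_assoc, add_comm 1 m]

/-- The unary parameter drives `k` rounds of the loop, and the group written ahead of it makes `k +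
1`. Moving `k'` back restores the parameter for the next copy. -/
theorem runs_copiesProg (u : List (Option Bool)) (w : List Bool) (hw : w.count true = D.h)
    (r : D.ρ) (k : ℕ) (G : List D.Group) :
    RunsWithin (copiesProg D r) (state D u G (w.map some) [] (unary k) [])
      (state D u (G ++ copyGroups D k w r) (w.map some) [] (unary k) []) ((k + 1) * (D.q + 6) + 2)
      (pot D w.length G.length) (pot D w.length (G ++ copyGroups D k w r).length) := by
  have h₁ := runs_groupProg D u w hw r 0 G (unary k) (unary 0)
  have h₂ := runs_copiesLoop D u w hw r k 0 (G ++ [(w, r, 0)])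
  have h₃ (G : List D.Group) : Exec (move .k' .k fun _ => true)
      (state D u G (w.map some) [] [] (unary k)) _ _ :=
    exec_move (by decide) (r := []) (by simp) (unary k) _ (by simp [state]) (by simp)
  have h₄ : copyGroups D k w r =
      [(w, r, 0)] ++ (List.range' (0 + 1) k).map fun j => (w, r, j) := by
    rw [copyGroups, List.range_eq_range', List.range'_succ]
    rfl
  rw [zero_add, zero_add, List.length_append, List.length_singleton] at h₂
  refine (h₁.seq (h₂.seq ((h₃ _).runsWithin _))).congr ?_ ?_ ?_
  · simp [state, h₄, unary]
  · simp [h₄, add_comm, add_left_comm]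
  · simp only [unary, List.length_replicate]
    linarith

end AttachMachine

/-! ### Enumerating the words of marks by nested loops -/

namespace AttachMachine

open StackProg

variable (D : Params)

/-- Write the rows of all groups of the word on `a`. -/
def bodyProg : List D.ρ → StackProg Stk (Option Bool)
  | [] => skip
  | r :: l => seq (copiesProg D r) (bodyProg l)

theorem runs_bodyProg (u : List (Option Bool)) (w : List Bool) (hw : w.count true = D.h) (k : ℕ)
    (l : List D.ρ) : ∀ G : List D.Group,
    RunsWithin (bodyProg D l) (state D u G (w.map some) [] (unary k) [])
      (state D u (G ++ l.flatMap (copyGroups D k w)) (w.map some) [] (unary k) [])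
      (l.length * ((k + 1) * (D.q + 6) + 2) + 1)
      (pot D w.length G.length) (pot D w.length (G ++ l.flatMap (copyGroups D k w)).length) := by
  induction l with
  | nil =>
    intro G
    exact (Exec.skip.runsWithin _).congr (by simp) (by simp) (by simp)
  | cons r l ih =>
    intro G
    refine ((runs_copiesProg D u w hw r k G).seq (ih _)).congr (by simp) (by simp) ?_
    rw [List.length_cons]
    linarith

/-- The words of length `m` with `j` marks. -/
def words : ℕ → ℕ → List (List Bool)
  | 0, m => [List.replicate m false]
  | _ + 1, 0 => []
  | j + 1, m + 1 => (words j m).map (· ++ [true]) ++ (words (j + 1) m).map (· ++ [false])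

theorem mem_words {j m : ℕ} {w : List Bool} :
    w ∈ words j m ↔ w.length = m ∧ w.count true = j := by
  induction m generalizing j w with
  | zero =>
    cases j with
    | zero =>
      simp only [words, List.replicate_zero, List.mem_singleton, List.length_eq_zero_iff]
      exact ⟨by rintro rfl; simp, fun h => h.1⟩
    | succ j =>
      simp only [words, List.not_mem_nil, List.length_eq_zero_iff, false_iff, not_and]
      rintro rfl
      simp
  | succ m ih =>
    cases j with
    | zero =>
      simp only [words, List.mem_singleton]
      constructor
      · rintro rfl
        simp [List.count_replicate]
      · rintro ⟨h₁, h₂⟩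
        rw [eq_replicate_false_of_count h₂, h₁]
    | succ j =>
      simp only [words, List.mem_append, List.mem_map, ih]
      constructor
      · rintro (⟨w, ⟨h₁, h₂⟩, rfl⟩ | ⟨w, ⟨h₁, h₂⟩, rfl⟩) <;> simp [h₁, h₂]
      · rintro ⟨h₁, h₂⟩
        induction w using List.reverseRecOn with
        | nil => simp at h₁
        | append_singleton w c _ =>
          cases c
          · exact Or.inr ⟨w, ⟨by simpa using h₁, by simpa using h₂⟩, rfl⟩
          · exact Or.inl ⟨w, ⟨by simpa using h₁, by simpa using h₂⟩, rfl⟩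

theorem nodup_words (j m : ℕ) : (words j m).Nodup := by
  induction m generalizing j with
  | zero => cases j <;> simp [words]
  | succ m ih =>
    cases j with
    | zero => simp [words]
    | succ j =>
      have inj (c : Bool) : Function.Injective fun w : List Bool => w ++ [c] :=
        fun a b h => by simpa using h
      refine List.Nodup.append ((ih j).map (inj true)) ((ih (j + 1)).map (inj false)) ?_
      intro w h₁ h₂
      simp only [List.mem_map] at h₁ h₂
      obtain ⟨w₁, -, rfl⟩ := h₁
      obtain ⟨w₂, -, h⟩ := h₂
      simpa using congrArg List.getLast? h

/-- The recursion of `words` is Pascal's rule, so the length is a binomial coefficient; the crude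
bound suffices, as `j` will be the constant `h`. -/
theorem length_words_le (j m : ℕ) : (words j m).length ≤ (m + 1) ^ j := by
  induction m generalizing j with
  | zero => cases j <;> simp [words]
  | succ m ih =>
    cases j with
    | zero => simp [words]
    | succ j =>
      simp only [words, List.length_append, List.length_map]
      calc (words j m).length + (words (j + 1) m).length
          ≤ (m + 1) ^ j + (m + 1) ^ (j + 1) := add_le_add (ih j) (ih (j + 1))
        _ = (m + 1 + 1) * (m + 1) ^ j := by ring
        _ ≤ (m + 1 + 1) * (m + 1 + 1) ^ j := by gcongr; omega
        _ = (m + 1 + 1) ^ (j + 1) := by ring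

/-- Run `body` for all ways of placing `j` marks on the unmarked symbols of `b`. -/
def selProg (body : StackProg Stk (Option Bool)) : ℕ → StackProg Stk (Option Bool)
  | 0 => seq (move .b .a fun _ => true) <| seq body <| move .a .b fun x => x == some false
  | j + 1 => seq (loop .b (fun _ => true) fun _ => seq (push .a (some true)) <|
      seq (selProg body j) <| seq (pop .a) <| push .a (some false)) <|
      move .a .b fun x => x == some false

/-- The time of `selProg`. -/
def selTime (n T : ℕ) : ℕ → ℕ
  | 0 => (2 * n + 1) + (T + (2 * n + 1))
  | j + 1 => n * (selTime n T j + 4) + 1 + (2 * n + 1)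

/-- Since `w` is empty or begins with a mark, the unmarked run on top of `a` ends exactly where `w`
begins. -/
theorem exec_restore (u : List (Option Bool)) (G : List D.Group) (w : List Bool)
    (hw : w.head? ≠ some false) (m : ℕ) (k : List (Option Bool)) :
    Exec (move .a .b fun x => x == some false)
      (state D u G ((List.replicate m false ++ w).map some) [] k [])
      (state D u G (w.map some) (List.replicate m (some false)) k []) (2 * m + 1) := by
  refine (exec_move (by decide) (r := w.map some) ?_ (List.replicate m (some false)) _
    (by simp [state]) (by simp)).congr (by simp [state]) (by simp)
  cases w with
  | nil => simp
  | cons c w => cases c <;> simp_all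

/-- The stack `a` holds the part `w` of the word that is already fixed, and `b` holds `m` undecided
positions. Each round of the loop marks the next position, places the other `j` marks on the
positions left in `b`, then unmarks that position and goes on. This is the order of `words`, whose
recursion is on the last letter. -/
theorem runs_selProg (u : List (Option Bool)) (k : List (Option Bool)) (n T : ℕ)
    (body : StackProg Stk (Option Bool)) (f : List Bool → List D.Group)
    (hbody : ∀ w : List Bool, w.length = n → w.count true = D.h → ∀ G : List D.Group,
      RunsWithin body (state D u G (w.map some) [] k []) (state D u (G ++ f w) (w.map some) [] k [])
        T (pot D n G.length) (pot D n (G ++ f w).length)) (j : ℕ) :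
    ∀ (m : ℕ) (w : List Bool) (G : List D.Group), w.head? ≠ some false → w.length + m = n →
      w.count true + j = D.h →
      RunsWithin (selProg body j) (state D u G (w.map some) (List.replicate m (some false)) k [])
        (state D u (G ++ (words j m).flatMap fun e => f (e ++ w)) (w.map some)
          (List.replicate m (some false)) k []) (selTime n T j)
        (pot D n G.length)
        (pot D n (G ++ (words j m).flatMap fun e => f (e ++ w)).length) := by
  induction j with
  | zero =>
    intro m w G hw hm hj
    have h₁ : Exec (move .b .a fun _ => true)
        (state D u G (w.map some) (List.replicate m (some false)) k [])
        (state D u G ((List.replicate m false ++ w).map some) [] k []) (2 * m + 1) :=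
      (exec_move (by decide) (r := []) (by simp) (List.replicate m (some false)) _
        (by simp [state]) (by simp)).congr (by simp [state]) (by simp)
    have h₂ := hbody (List.replicate m false ++ w) (by simp; omega)
      (by simp [List.count_replicate]; omega) G
    refine ((h₁.runsWithin _).seq (h₂.seq
      ((exec_restore D u _ w hw m k).runsWithin _))).congr (by simp [words]) (by simp [words]) ?_
    simp only [selTime]
    omega
  | succ j ih =>
    -- For the loop alone the condition on the head of `w` is dropped: later rounds have unmarked
    -- symbols on top of `a`, while the inner call always sees the fresh mark.
    have aux : ∀ (m : ℕ) (w : List Bool) (G : List D.Group), w.length + m = n →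
      w.count true + (j + 1) = D.h →
      RunsWithin (loop .b (fun _ => true) fun _ => seq (push .a (some true)) <|
          seq (selProg body j) <| seq (pop .a) <| push .a (some false))
        (state D u G (w.map some) (List.replicate m (some false)) k [])
        (state D u (G ++ (words (j + 1) m).flatMap fun e => f (e ++ w))
          ((List.replicate m false ++ w).map some) [] k []) (m * (selTime n T j + 4) + 1)
        (pot D n G.length)
        (pot D n (G ++ (words (j + 1) m).flatMap fun e => f (e ++ w)).length) := by
      intro m
      induction m with
      | zero =>
        intro w G hm hj
        exact ((Exec.loop_exit (by simp [state])).congr (by simp [words])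
          (by simp)).runsWithin _ |>.congr rfl (by simp [words]) le_rfl
      | succ m ihm =>
        intro w G hm hj
        have h₁ := ih m (true :: w) G (by simp) (by simp; omega) (by simp; omega)
        have h₂ := ihm (false :: w) (G ++ (words j m).flatMap fun e => f (e ++ true :: w))
          (by simp; omega) (by simpa using hj)
        have h₃ : Exec (push .a (some true))
            (state D u G (w.map some) (List.replicate m (some false)) k [])
            (state D u G ((true :: w).map some) (List.replicate m (some false)) k []) 1 :=
          Exec.push_of (by simp [state])
        have h₄ (G : List D.Group) : Exec (seq (pop .a) (push .a (some false)))
            (state D u G ((true :: w).map some) (List.replicate m (some false)) k [])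
            (state D u G ((false :: w).map some) (List.replicate m (some false)) k []) 2 :=
          Exec.pop.seq (Exec.push_of (by simp [state]))
        have h₅ := (h₃.runsWithin _).seq (h₁.seq ((h₄ _).runsWithin _))
        refine (RunsWithin.loop_step (T := 1 + (selTime n T j + 2)) (a := some false)
          (l := List.replicate m (some false))
          (by simp [state, List.replicate_succ]) rfl ?_ h₂).congr ?_ ?_ ?_
        · simpa [state] using h₅
        · congr 1
          · simp [words, List.flatMap_append, List.flatMap_map]
          · simp [List.replicate_succ']
        · simp [words, List.flatMap_append, List.flatMap_map, List.length_flatMap]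
        · linarith
    intro m w G hw hm hj
    refine ((aux m w G hm hj).seq ((exec_restore D u _ w hw m k).runsWithin _)).mono ?_
    simp only [selTime]
    gcongr <;> omega

end AttachMachine

/-! ### The complete program and its polynomial running time -/

namespace AttachMachine

open StackProg

variable (D : Params)

/-- Copy the rows of the input to `out` and put an unmarked symbol onto `b` for each vertex. -/
def readRows : StackProg Stk (Option Bool) :=
  loop .inp (fun _ => true) fun x => match x with
    | none => seq (push .out none) (push .b (some false))
    | some c => push .out (some c)

theorem exec_readRows (v : List (Option Bool)) : ∀ (o k : List (Option Bool)) (m : ℕ),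
    Exec readRows (conf v o [] (List.replicate m (some false)) k [] [] [])
      (conf [] (v.reverse ++ o) [] (List.replicate (v.count none + m) (some false)) k [] [] [])
      (3 * v.length + 1) := by
  induction v with
  | nil =>
    intro o k m
    exact (Exec.loop_exit (by simp)).congr (by simp) (by simp)
  | cons c v ih =>
    intro o k m
    cases c with
    | none =>
      have h₁ : Exec (seq (push .out none) (push .b (some false)))
          (conf v o [] (List.replicate m (some false)) k [] [] [])
          (conf v (none :: o) [] (List.replicate (m + 1) (some false)) k [] [] []) 2 :=
        Exec.push.seq (Exec.push_of (by simp [List.replicate_succ]))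
      exact (Exec.loop_step (s := Stk.inp) (a := none) (l := v) rfl rfl (by simpa using h₁)
        (ih (none :: o) k (m + 1))).congr (by simp [add_assoc, add_comm 1 m]) (by simp; omega)
    | some c =>
      have h₁ : Exec (push .out (some c))
          (conf v o [] (List.replicate m (some false)) k [] [] [])
          (conf v (some c :: o) [] (List.replicate m (some false)) k [] [] []) 1 :=
        Exec.push_of (by simp)
      exact (Exec.loop_step (s := Stk.inp) (a := some c) (l := v) rfl rfl (by simpa using h₁)
        (ih (some c :: o) k m)).congr (by simp) (by simp; omega)

/-- The program that attaches the copies. -/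
def mainProg : StackProg Stk (Option Bool) :=
  seq (scan .inp .k .out (fun x => x == some true) id) <| seq readRows <|
    seq (selProg (bodyProg D D.R) D.h) <| seq (clear .k) <| seq (clear .b) <| seq (clear .p) <|
    move .out .inp fun _ => true

/-- The groups of new vertices for a graph with `n` vertices and parameter `k`. -/
def allGroups (k n : ℕ) : List D.Group :=
  (words D.h n).flatMap fun w => D.R.flatMap (copyGroups D k w)

theorem length_allGroups_le (k n : ℕ) :
    (allGroups D k n).length ≤ (n + 1) ^ D.h * (D.R.length * (k + 1)) := by
  simp only [allGroups, copyGroups, List.length_flatMap, List.length_map, List.length_range,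
    List.map_const', List.sum_replicate, smul_eq_mul]
  exact Nat.mul_le_mul_right _ (length_words_le _ _)

theorem length_fst_of_mem_allGroups {k n : ℕ} {g : D.Group} (hg : g ∈ allGroups D k n) :
    g.1.length = n := by
  simp only [allGroups, copyGroups, List.mem_flatMap, List.mem_map] at hg
  obtain ⟨w, hw, r, -, j, -, rfl⟩ := hg
  exact (mem_words.1 hw).1

/-- The hypothesis `hv` lets the first scan stop exactly after the unary parameter. The input is
copied to `out` as it is read, being a prefix of the output, and each separator `none` yields one
undecided position on `b`. -/
theorem exec_mainProg (k n : ℕ) (v : List (Option Bool)) (hv : v.head? ≠ some (some true))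
    (hn : v.count none = n) :
    Exec (mainProg D) (conf (unary k ++ v) [] [] [] [] [] [] [])
      (conf (unary k ++ v ++ groupsWord D (allGroups D k n)) [] [] [] [] [] [] [])
      (7 * k + 5 * v.length + 2 * n + 2 * (D.q * (allGroups D k n).length) +
        2 * (groupsWord D (allGroups D k n)).length + 6 +
        selTime n (D.R.length * ((k + 1) * (D.q + 6) + 2) + 1) D.h +
        pot D n (allGroups D k n).length) := by
  have h₁ : Exec (scan .inp .k .out (fun x => x == some true) id)
      (conf (unary k ++ v) [] [] [] [] [] [] []) (conf v (unary k) [] [] (unary k) [] [] [])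
      (3 * k + 1) := by
    refine (exec_scan (s := Stk.inp) (t := Stk.k) (o := Stk.out) (by decide) (by decide) (by decide)
      (c := fun x => x == some true) (y := id) (r := v) ?_ (unary k)
      (conf (unary k ++ v) [] [] [] [] [] [] []) rfl (by simp [unary])).congr
      (by simp [unary]) (by simp [unary])
    intro x hx
    simp only [beq_eq_false_iff_ne]
    rintro rfl
    exact hv hx
  have h₂ := exec_readRows v (unary k) (unary k) 0
  rw [hn, List.replicate_zero, add_zero] at h₂
  obtain ⟨t, h₃, ht⟩ := runs_selProg D (unary k ++ v) (unary k) n _ (bodyProg D D.R)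
    (fun w => D.R.flatMap (copyGroups D k w))
    (fun w hw hw' G => by subst hw; exact runs_bodyProg D (unary k ++ v) w hw' k D.R G)
    D.h n [] [] (by simp) (by simp) (by simp)
  simp only [List.append_nil, List.nil_append] at h₃ ht
  change Exec _ _ (state D (unary k ++ v) (allGroups D k n) _ _ _ _) _ at h₃
  change _ ≤ _ + pot D n (allGroups D k n).length at ht
  have h₄ : state D (unary k ++ v) [] (([] : List Bool).map some)
      (List.replicate n (some false)) (unary k) [] =
      conf [] (v.reverse ++ unary k) [] (List.replicate n (some false)) (unary k) [] [] [] := by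
    simp [state, groupsWord, unary]
  rw [h₄] at h₃
  refine (h₁.seq <| h₂.seq <| h₃.seq <| (exec_clear _ _ rfl).seq <| (exec_clear _ _ rfl).seq <|
    (exec_clear _ _ rfl).seq <| exec_move (by decide) (r := []) (by simp) _ _
      (List.append_nil _).symm (by simp)).congr ?_ ?_
  · simp [state]
  · simp [state, unary]
    omega

/-- An upper bound on the number of groups. -/
def groupBound (N : ℕ) : ℕ := (N + 1) ^ D.h * (D.R.length * (N + 1))

/-- The running time of the machine. -/
def mainTime (N : ℕ) : ℕ :=
  14 * N + 2 * (D.q * groupBound D N) +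
    2 * (groupBound D N * (D.q * (1 + N + D.q * groupBound D N))) + 6 +
    selTime N (D.R.length * ((N + 1) * (D.q + 6) + 2) + 1) D.h +
    (D.h + D.q + 6) * (D.q * groupBound D N) * (1 + N + D.q * groupBound D N) + 1

theorem selTime_mono {n n' T T' : ℕ} (hn : n ≤ n') (hT : T ≤ T') (j : ℕ) :
    selTime n T j ≤ selTime n' T' j := by
  induction j with
  | zero => simp only [selTime]; omega
  | succ j ih => simp only [selTime]; gcongr

/-- The nesting depth `j` is fixed, and each level applies a polynomial expression to the bound of
the level below. -/
theorem exists_polynomial_selTime {n T : ℕ → ℕ} (hn : ∃ P : Polynomial ℕ, ∀ N, P.eval N = n N)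
    (hT : ∃ P : Polynomial ℕ, ∀ N, P.eval N = T N) (j : ℕ) :
    ∃ P : Polynomial ℕ, ∀ N, P.eval N = selTime (n N) (T N) j := by
  obtain ⟨P, hP⟩ := hn
  obtain ⟨Q, hQ⟩ := hT
  induction j with
  | zero => exact ⟨(2 * P + 1) + (Q + (2 * P + 1)), fun N => by simp [selTime, hP, hQ]⟩
  | succ j ih =>
    obtain ⟨R, hR⟩ := ih
    exact ⟨P * (R + 4) + 1 + (2 * P + 1), fun N => by simp [selTime, hP, hR]⟩

open Polynomial in
theorem exists_polynomial_mainTime : ∃ P : ℕ[X], ∀ N, P.eval N = mainTime D N := by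
  obtain ⟨P, hP⟩ := exists_polynomial_selTime (n := fun N => N)
    (T := fun N => D.R.length * ((N + 1) * (D.q + 6) + 2) + 1) ⟨X, fun N => by simp⟩
    ⟨(D.R.length : ℕ[X]) * ((X + 1) * ((D.q : ℕ[X]) + 6) + 2) + 1, fun N => by simp⟩ D.h
  let B : ℕ[X] := (X + 1) ^ D.h * ((D.R.length : ℕ[X]) * (X + 1))
  have hB : ∀ N, B.eval N = groupBound D N := fun N => by simp [B, groupBound]
  refine ⟨14 * X + 2 * ((D.q : ℕ[X]) * B) + 2 * (B * ((D.q : ℕ[X]) * (1 + X + (D.q : ℕ[X]) * B))) +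
    6 + P + ((D.h : ℕ[X]) + (D.q : ℕ[X]) + 6) * ((D.q : ℕ[X]) * B) * (1 + X + (D.q : ℕ[X]) * B) + 1,
    fun N => ?_⟩
  simp [mainTime, hP, hB]

theorem exists_encode_eq (I : ParamGraph) : ∃ v : List (Option Bool),
    I.encode = unary I.k ++ v ∧ v.head? ≠ some (some true) ∧ v.count none = I.n := by
  refine ⟨_, rfl, ?_, ?_⟩
  · cases List.finRange I.n <;> simp
  · rw [List.count_flatMap]
    have : ((List.count none) ∘ fun v : Fin I.n => none ::
        ((List.finRange I.n).filter (fun u => u < v)).map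
          fun u => some (@decide (I.graph.Adj v u) (Classical.propDecidable _))) =
        fun _ => 1 := by
      funext v
      simp [List.count_eq_zero]
    rw [this]
    simp

/-- A map that appends the rows of the attached groups to the encoding of its argument is
computable in polynomial time. -/
theorem nonempty_computableInPolyTime (f : ParamGraph → ParamGraph)
    (hf : ∀ I, (f I).encode = I.encode ++ groupsWord D (allGroups D I.k I.n)) :
    Nonempty (Turing.TM2ComputableInPolyTime ParamGraph.encode ParamGraph.encode f) := by
  obtain ⟨P, hP⟩ := exists_polynomial_mainTime D
  have key : ∀ I, Nonempty (Turing.TM2OutputsInTime ((mainProg D).toFinTM2 .inp) I.encode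
      (some (f I).encode) (P.eval I.encode.length)) := by
    intro I
    obtain ⟨v, hI, hv, hn⟩ := exists_encode_eq I
    have h₁ := exec_mainProg D I.k I.n v hv hn
    rw [← hI, ← hf, ← update_nil_inp, ← update_nil_inp] at h₁
    obtain ⟨h₂⟩ := outputsInTime_toFinTM2 h₁
    refine ⟨⟨h₂.toEvalsTo, h₂.steps_le_m.trans ?_⟩⟩
    rw [hP]
    -- Both `k` and `n` are at most the input length: the parameter is in unary, and every vertex
    -- contributes a separator.
    have hN : I.encode.length = I.k + v.length := by simp [hI, unary]
    have hnv : I.n ≤ v.length := hn ▸ List.count_le_length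
    have hg : (allGroups D I.k I.n).length ≤ groupBound D I.encode.length := by
      refine (length_allGroups_le D I.k I.n).trans ?_
      unfold groupBound
      gcongr <;> omega
    have hw : (groupsWord D (allGroups D I.k I.n)).length ≤ groupBound D I.encode.length *
        (D.q * (1 + I.encode.length + D.q * groupBound D I.encode.length)) := by
      refine (length_groupsWord_le D I.n _ fun g => length_fst_of_mem_allGroups D).trans ?_
      gcongr
      omega
    have hs : selTime I.n (D.R.length * ((I.k + 1) * (D.q + 6) + 2) + 1) D.h ≤
        selTime I.encode.length (D.R.length * ((I.encode.length + 1) * (D.q + 6) + 2) + 1) D.h := by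
      apply selTime_mono
      · omega
      · gcongr
        omega
    have hp : pot D I.n (allGroups D I.k I.n).length ≤ (D.h + D.q + 6) *
        (D.q * groupBound D I.encode.length) *
        (1 + I.encode.length + D.q * groupBound D I.encode.length) := by
      unfold pot
      gcongr
      omega
    have hq : D.q * (allGroups D I.k I.n).length ≤ D.q * groupBound D I.encode.length := by gcongr
    unfold mainTime
    omega
  exact ⟨{
    tm := (mainProg D).toFinTM2 .inp
    inputAlphabet := Equiv.refl _
    outputAlphabet := Equiv.refl _
    time := P
    outputsFun := fun I => by
      have := (key I).some
      rw [← List.map_id I.encode, ← List.map_id (f I).encode, List.length_map] at this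
      exact this }⟩

end AttachMachine

/-! ### Edge modifications and attached copies -/

theorem modifyEdges_adj {W : Type*} {G : SimpleGraph W} {F : Finset (Sym2 W)} {a b : W} :
    (modifyEdges G F).Adj a b ↔
      (G.Adj a b ∧ s(a, b) ∉ F ∨ s(a, b) ∈ F ∧ ¬ G.Adj a b) ∧ a ≠ b := by
  simp [modifyEdges, Set.mem_symmDiff]

theorem modifyEdges_adj_of_notMem {W : Type*} {G : SimpleGraph W} {F : Finset (Sym2 W)} {a b : W}
    (h : s(a, b) ∉ F) : (modifyEdges G F).Adj a b ↔ G.Adj a b := by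
  rw [modifyEdges_adj]
  exact ⟨fun h' => by tauto, fun h' => ⟨Or.inl ⟨h', h⟩, h'.ne⟩⟩

/-- Serves both directions of the equivalence, with `F'` the image of `F` or `F` the preimage of
`F'`. -/
theorem modifyEdges_adj_map {W W' : Type*} {G : SimpleGraph W} {G' : SimpleGraph W'} (j : G ↪g G')
    {F : Finset (Sym2 W)} {F' : Finset (Sym2 W')} (hF : ∀ e, Sym2.map j e ∈ F' ↔ e ∈ F) {a b : W} :
    (modifyEdges G' F').Adj (j a) (j b) ↔ (modifyEdges G F).Adj a b := by
  have := hF s(a, b)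
  rw [Sym2.map_mk] at this
  rw [modifyEdges_adj, modifyEdges_adj, this, j.map_adj_iff, j.injective.ne_iff]

/-- An induced embedding preserves and reflects edges, non-edges and distinctness. This is the only
place where the three kinds are told apart. -/
theorem ModificationKind.map_mem_allowed {W W' : Type*} {G : SimpleGraph W} {G' : SimpleGraph W'}
    (j : G ↪g G') (kind : ModificationKind) (e : Sym2 W) :
    Sym2.map j e ∈ kind.allowed G' ↔ e ∈ kind.allowed G := by
  induction e with | _ a b
  cases kind <;> simp [ModificationKind.allowed, j.map_adj_iff, j.injective.eq_iff]

/-- At most `k` modifications of the given kind make `G` an `H`-free graph. -/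
def CanModify {V W : Type*} (H : SimpleGraph V) (kind : ModificationKind) (G : SimpleGraph W)
    (k : ℕ) : Prop :=
  ∃ F : Finset (Sym2 W), (F : Set (Sym2 W)) ⊆ kind.allowed G ∧ F.card ≤ k ∧
    InducedFree H (modifyEdges G F)

theorem CanModify.of_iso {V W W' : Type*} {H : SimpleGraph V} {kind : ModificationKind}
    {G : SimpleGraph W} {G' : SimpleGraph W'} {k : ℕ} (e : G ≃g G')
    (h : CanModify H kind G k) : CanModify H kind G' k := by
  obtain ⟨F, hF, hk, hH⟩ := h
  refine ⟨F.map e.toEquiv.toEmbedding.sym2Map, ?_, by simpa using hk, ?_⟩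
  · intro x hx
    simp only [Finset.coe_map, Set.mem_image, Finset.mem_coe] at hx
    obtain ⟨x, hx, rfl⟩ := hx
    exact (kind.map_mem_allowed e.toEmbedding x).2 (hF hx)
  · rintro ⟨ψ⟩
    let e' : modifyEdges G F ≃g modifyEdges G' (F.map e.toEquiv.toEmbedding.sym2Map) :=
      ⟨e.toEquiv, modifyEdges_adj_map e.toEmbedding fun x =>
        Finset.mem_map' e.toEquiv.toEmbedding.sym2Map⟩
    exact hH ⟨(SimpleGraph.Iso.toEmbedding e'.symm).comp ψ⟩

theorem CanModify.iso_iff {V W W' : Type*} {H : SimpleGraph V} {kind : ModificationKind}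
    {G : SimpleGraph W} {G' : SimpleGraph W'} {k : ℕ} (e : G ≃g G') :
    CanModify H kind G k ↔ CanModify H kind G' k :=
  ⟨.of_iso e, .of_iso e.symm⟩

/-! ### Equivalence of the two instances -/

section attachCopies

variable {V W : Type*} (H : SimpleGraph V) (S : Set V) (r : ℕ) (G' : SimpleGraph W)
  (φ : ∀ C : CopyInComplete (H.induce S) W, H.induce S ≃g C.1.coe)

/-- The base graph is an induced subgraph of the graph with attached copies. -/
def attachCopiesInl : G' ↪g attachCopies H S r G' φ where
  toFun := Sum.inl
  inj' := Sum.inl_injective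
  map_rel_iff' := Iff.rfl

open Classical in
/-- The `i`-th copy of `H` that is attached at `C`. -/
noncomputable def attachedCopy (C : CopyInComplete (H.induce S) W) (i : Fin r) (v : V) :
    W ⊕ (CopyInComplete (H.induce S) W × Fin r × ↥Sᶜ) :=
  if hv : v ∈ S then .inl (φ C ⟨v, hv⟩) else .inr (C, i, ⟨v, hv⟩)

variable {H S r G' φ}

theorem attachedCopy_of_mem {C : CopyInComplete (H.induce S) W} {i : Fin r} {v : V} (hv : v ∈ S) :
    attachedCopy H S r φ C i v = .inl (φ C ⟨v, hv⟩ : W) := dif_pos hv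

theorem attachedCopy_of_notMem {C : CopyInComplete (H.induce S) W} {i : Fin r} {v : V}
    (hv : v ∉ S) : attachedCopy H S r φ C i v = .inr (C, i, ⟨v, hv⟩) := dif_neg hv

theorem attachedCopy_injective (C : CopyInComplete (H.induce S) W) (i : Fin r) :
    Function.Injective (attachedCopy H S r φ C i) := by
  intro v w h
  by_cases hv : v ∈ S <;> by_cases hw : w ∈ S
  · rw [attachedCopy_of_mem hv, attachedCopy_of_mem hw] at h
    have := (φ C).injective (Subtype.ext (Sum.inl_injective h))
    exact congrArg Subtype.val this
  · rw [attachedCopy_of_mem hv, attachedCopy_of_notMem hw] at h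
    cases h
  · rw [attachedCopy_of_notMem hv, attachedCopy_of_mem hw] at h
    cases h
  · rw [attachedCopy_of_notMem hv, attachedCopy_of_notMem hw] at h
    simpa using h

/-- One end must lie outside `S`: between two vertices of `S` the adjacency is that of `G'`, which
need not agree with `H`. -/
theorem attachCopies_adj_attachedCopy {C : CopyInComplete (H.induce S) W} {i : Fin r} {v w : V}
    (hv : v ∉ S) :
    (attachCopies H S r G' φ).Adj (attachedCopy H S r φ C i v) (attachedCopy H S r φ C i w) ↔
      H.Adj v w := by
  rw [attachedCopy_of_notMem hv]
  by_cases hw : w ∈ S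
  · rw [attachedCopy_of_mem hw]
    constructor
    · rintro ⟨y, hy, h⟩
      have : y = ⟨w, hw⟩ := (φ C).injective (Subtype.ext hy)
      subst this
      exact h.symm
    · exact fun h => ⟨⟨w, hw⟩, rfl, h.symm⟩
  · rw [attachedCopy_of_notMem hw]
    exact ⟨fun h => h.2.2, fun h => ⟨rfl, rfl, h⟩⟩

/-- This bounds the degree of a new vertex by its degree in `H`. -/
theorem exists_eq_attachedCopy_of_adj {C : CopyInComplete (H.induce S) W} {i : Fin r} {x : ↥Sᶜ}
    {a : W ⊕ (CopyInComplete (H.induce S) W × Fin r × ↥Sᶜ)}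
    (h : (attachCopies H S r G' φ).Adj (.inr (C, i, x)) a) :
    ∃ w, H.Adj x w ∧ attachedCopy H S r φ C i w = a := by
  rcases a with u | ⟨D, j, y⟩
  · obtain ⟨y, hy, h⟩ := h
    exact ⟨y, h.symm, by rw [attachedCopy_of_mem y.2, ← hy]⟩
  · obtain ⟨rfl, rfl, h⟩ := h
    exact ⟨y, h, attachedCopy_of_notMem y.2⟩

open Classical in
/-- A solution for `G'` is a solution for the graph with attached copies: new vertices have degree
at most `d`, so they are not images of vertices in `S`. -/
theorem CanModify.attachCopies [Fintype V] [DecidableRel H.Adj] {d : ℤ}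
    (hS : S = {v | d < (H.degree v : ℤ)}) {kind : ModificationKind} {k : ℕ}
    (h : CanModify (H.induce S) kind G' k) :
    CanModify H kind (attachCopies H S r G' φ) k := by
  obtain ⟨F, hF, hk, hH⟩ := h
  let J := attachCopiesInl H S r G' φ
  have hJ : ∀ e, Sym2.map J e ∈ F.map J.toEmbedding.sym2Map ↔ e ∈ F := fun e =>
    Finset.mem_map' J.toEmbedding.sym2Map
  refine ⟨F.map J.toEmbedding.sym2Map, ?_, by simpa using hk, ?_⟩
  · intro x hx
    simp only [Finset.coe_map, Set.mem_image, Finset.mem_coe] at hx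
    obtain ⟨x, hx, rfl⟩ := hx
    exact (kind.map_mem_allowed J x).2 (hF hx)
  · rintro ⟨ψ⟩
    have hψ : ∀ v ∈ S, ∃ u, ψ v = .inl u := by
      intro v hv
      rcases hv' : ψ v with u | ⟨C, i, x⟩
      · exact ⟨u, rfl⟩
      · exfalso
        -- No pair of the modification set contains a new vertex, so the neighbourhood of `ψ v` is
        -- unmodified and the degree of `v` is at most that of `x`.
        have hsub : (H.neighborFinset v).image ψ ⊆
            (H.neighborFinset x).image (attachedCopy H S r φ C i) := by
          intro a ha
          simp only [Finset.mem_image, SimpleGraph.mem_neighborFinset] at ha ⊢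
          obtain ⟨w, hw, rfl⟩ := ha
          have hadj := ψ.map_adj_iff.2 hw
          rw [hv', modifyEdges_adj_of_notMem] at hadj
          · exact exists_eq_attachedCopy_of_adj hadj
          · intro hmem
            simp only [Finset.mem_map] at hmem
            obtain ⟨e, -, he⟩ := hmem
            have : (Sum.inr (C, i, x) : W ⊕ (CopyInComplete (H.induce S) W × Fin r × ↥Sᶜ)) ∈
                Sym2.map J e := by
              rw [show Sym2.map J e = _ from he]
              exact Sym2.mem_mk_left _ _
            obtain ⟨u, -, hu⟩ := Sym2.mem_map.1 this
            exact Sum.inl_ne_inr hu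
        have h₁ := Finset.card_le_card hsub
        rw [Finset.card_image_of_injective _ ψ.injective,
          Finset.card_image_of_injective _ (attachedCopy_injective C i),
          SimpleGraph.card_neighborFinset_eq_degree,
          SimpleGraph.card_neighborFinset_eq_degree] at h₁
        have h₂ : ¬ d < (H.degree (x : V) : ℤ) := by
          intro h
          exact x.2 (hS ▸ h)
        rw [hS] at hv
        have h₃ : d < (H.degree v : ℤ) := hv
        omega
    choose g hg using fun v : S => hψ v v.2
    refine hH ⟨⟨⟨g, ?_⟩, ?_⟩⟩
    · intro v w hvw
      apply Subtype.ext
      apply ψ.injective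
      rw [hg v, hg w]
      exact congrArg _ hvw
    · intro v w
      rw [SimpleGraph.comap_adj]
      exact (modifyEdges_adj_map J hJ).symm.trans (by
        have := ψ.map_adj_iff (v := (v : V)) (w := w)
        rw [hg v, hg w] at this
        exact this)

open Classical in
/-- A solution for the graph with attached copies restricts to a solution for `G'`: one of the
`k + 1` copies of `H` at a copy of `H[S]` is not modified. -/
theorem CanModify.of_attachCopies {kind : ModificationKind} {k : ℕ}
    {φ : ∀ C : CopyInComplete (H.induce S) W, H.induce S ≃g C.1.coe}
    (h : CanModify H kind (_root_.attachCopies H S (k + 1) G' φ) k) :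
    CanModify (H.induce S) kind G' k := by
  obtain ⟨F, hF, hk, hH⟩ := h
  let J := attachCopiesInl H S (k + 1) G' φ
  have hJ : ∀ e, Sym2.map J e ∈ F ↔
      e ∈ F.preimage (Sym2.map J) (Sym2.map.injective J.injective).injOn := by simp
  refine ⟨F.preimage (Sym2.map J) (Sym2.map.injective J.injective).injOn, ?_, ?_, ?_⟩
  · intro x hx
    exact (kind.map_mem_allowed J x).1 (hF ((hJ x).2 hx))
  · refine (Finset.card_le_card_of_injOn (Sym2.map J) (fun e he => (hJ e).2 he)
      (Sym2.map.injective J.injective).injOn).trans hk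
  · rintro ⟨ψ⟩
    -- The surviving induced `H[S]` need not be a subgraph of `G'`, which is why copies are attached
    -- throughout the complete graph.
    let g : SimpleGraph.Copy (H.induce S) (⊤ : SimpleGraph W) :=
      ⟨⟨ψ, fun h => ψ.injective.ne h.ne⟩, ψ.injective⟩
    let C : CopyInComplete (H.induce S) W := ⟨g.toSubgraph, ⟨g.isoToSubgraph⟩⟩
    -- The isomorphism `φ C` may differ from `ψ`, but both map onto `C`, whose edges are exactly
    -- those of the modified graph between its vertices.
    have hC : ∀ y z : S, (modifyEdges (_root_.attachCopies H S (k + 1) G' φ) F).Adj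
        (.inl (φ C y : W)) (.inl (φ C z : W)) ↔ H.Adj y z := by
      intro y z
      refine (modifyEdges_adj_map J hJ).trans ?_
      obtain ⟨y', -, hy'⟩ := (φ C y).2
      obtain ⟨z', -, hz'⟩ := (φ C z).2
      have h₁ : C.1.coe.Adj (φ C y) (φ C z) ↔ H.Adj y z := (φ C).map_adj_iff
      rw [← h₁, SimpleGraph.Subgraph.coe_adj, ← hy', ← hz']
      change (modifyEdges G' _).Adj (ψ y') (ψ z') ↔ g.toSubgraph.Adj (ψ y') (ψ z')
      rw [ψ.map_adj_iff]
      constructor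
      · exact fun h => ⟨y', z', h, rfl, rfl⟩
      · rintro ⟨a, b, h, ha, hb⟩
        rw [← ψ.injective ha, ← ψ.injective hb]
        exact h
    -- Otherwise each `i` yields a pair in `F` with a new end in copy `i`. A new vertex lies in one
    -- copy only, so these are `k + 1` distinct pairs.
    have hfree : ∃ i : Fin (k + 1), ∀ v w, v ∉ S →
        s(attachedCopy H S (k + 1) φ C i v, attachedCopy H S (k + 1) φ C i w) ∉ F := by
      by_contra! hcon
      choose v w hv hvw using hcon
      have hinj : Function.Injective fun i =>
          s(attachedCopy H S (k + 1) φ C i (v i), attachedCopy H S (k + 1) φ C i (w i)) := by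
        intro i j hij
        dsimp only at hij
        have h₁ := Sym2.mem_mk_left (attachedCopy H S (k + 1) φ C i (v i))
          (attachedCopy H S (k + 1) φ C i (w i))
        rw [hij, Sym2.mem_iff, attachedCopy_of_notMem (hv i)] at h₁
        have h₂ : ∀ u, (Sum.inr (C, i, ⟨v i, hv i⟩) :
            W ⊕ (CopyInComplete (H.induce S) W × Fin (k + 1) × ↥Sᶜ)) =
              attachedCopy H S (k + 1) φ C j u → i = j := by
          intro u hu
          by_cases huS : u ∈ S
          · rw [attachedCopy_of_mem huS] at hu
            cases hu
          · rw [attachedCopy_of_notMem huS] at hu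
            simp only [Sum.inr.injEq, Prod.mk.injEq] at hu
            exact hu.2.1
        exact h₁.elim (h₂ _) (h₂ _)
      have hcard := Finset.card_le_card_of_injOn (s := Finset.univ) (t := F) _
        (fun i _ => hvw i) hinj.injOn
      rw [Finset.card_univ, Fintype.card_fin] at hcard
      omega
    obtain ⟨i, hi⟩ := hfree
    refine hH ⟨⟨⟨attachedCopy H S (k + 1) φ C i, attachedCopy_injective C i⟩, ?_⟩⟩
    intro v w
    change (modifyEdges _ F).Adj (attachedCopy H S (k + 1) φ C i v)
      (attachedCopy H S (k + 1) φ C i w) ↔ H.Adj v w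
    by_cases hv : v ∈ S
    · by_cases hw : w ∈ S
      · rw [attachedCopy_of_mem hv, attachedCopy_of_mem hw]
        exact hC ⟨v, hv⟩ ⟨w, hw⟩
      · rw [SimpleGraph.adj_comm, modifyEdges_adj_of_notMem (hi w v hw),
          attachCopies_adj_attachedCopy hw, SimpleGraph.adj_comm]
    · rw [modifyEdges_adj_of_notMem (hi v w hv), attachCopies_adj_attachedCopy hv]

end attachCopies

/-! ### Words of marks and copies -/

/-- The number of marks before a marked position selects its bit. The default `false` agrees with
the clause of `bits` for an exhausted list. -/
theorem AttachMachine.getElem_bits (bs w : List Bool) (u : ℕ) (hu : u < w.length) :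
    (AttachMachine.bits bs w)[u]'(by simpa using hu) =
      (w[u] && bs.getD ((w.take u).count true) false) := by
  induction w generalizing bs u with
  | nil => simp at hu
  | cons c w ih =>
    cases u with
    | zero => cases c <;> cases bs <;> simp [AttachMachine.bits]
    | succ u =>
      have := fun bs => ih bs u (by simpa using hu)
      cases c <;> cases bs <;> simp [AttachMachine.bits, this]

theorem List.exists_count_take_eq (w : List Bool) (j : ℕ) (hj : j < w.count true) :
    ∃ (u : ℕ) (hu : u < w.length), w[u] = true ∧ (w.take u).count true = j := by
  induction w generalizing j with
  | nil => simp at hj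
  | cons c w ih =>
    cases c with
    | false =>
      obtain ⟨u, hu, h₁, h₂⟩ := ih j (by simpa using hj)
      exact ⟨u + 1, by simpa using hu, by simpa using h₁, by simpa using h₂⟩
    | true =>
      cases j with
      | zero => exact ⟨0, by simp, by simp, by simp⟩
      | succ j =>
        obtain ⟨u, hu, h₁, h₂⟩ := ih j (by simpa using hj)
        exact ⟨u + 1, by simpa using hu, by simpa using h₁, by simpa using h₂⟩

theorem List.count_take_lt (w : List Bool) {u v : ℕ} (hu : u < w.length) (h : w[u] = true)
    (huv : u < v) : (w.take u).count true < (w.take v).count true := by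
  have h₁ : (w.take (u + 1)).count true = (w.take u).count true + 1 := by
    rw [List.take_succ_eq_append_getElem hu, h]
    simp
  have h₂ : (w.take (u + 1)).Sublist (w.take v) := List.take_sublist_take_left huv
  have := h₂.count_le true
  omega

/-- The marked positions of a word, numbered from left to right. -/
noncomputable def markEquiv (w : List Bool) (h : ℕ) (hw : w.count true = h) :
    {u : Fin w.length // w[u] = true} ≃ Fin h :=
  Equiv.ofBijective (fun u => ⟨(w.take u).count true, by
    have := w.count_take_lt u.1.2 u.2 u.1.2
    rw [List.take_length, hw] at this
    exact this⟩) <| by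
  constructor
  · intro u v huv
    simp only [Fin.mk.injEq] at huv
    rcases lt_trichotomy u.1 v.1 with h | h | h
    · exact absurd huv (w.count_take_lt u.1.2 u.2 h).ne
    · exact Subtype.ext h
    · exact absurd huv (w.count_take_lt v.1.2 v.2 h).ne'
  · intro j
    obtain ⟨u, hu, h₁, h₂⟩ := w.exists_count_take_eq j (by rw [hw]; exact j.2)
    exact ⟨⟨⟨u, hu⟩, h₁⟩, Fin.ext h₂⟩

namespace SimpleGraph

variable {V W : Type*} {A : SimpleGraph V}

/-- Turns equality of copies into conditions on vertex set and adjacency, from which the word and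
the graph on `Fin h` are recovered separately. -/
theorem Copy.toSubgraph_eq_iff {B : SimpleGraph W} (g : A.Copy B) (C : B.Subgraph) :
    g.toSubgraph = C ↔ Set.range g = C.verts ∧ ∀ a b, C.Adj (g a) (g b) ↔ A.Adj a b := by
  constructor
  · rintro rfl
    refine ⟨by simp, fun a b => ?_⟩
    constructor
    · rintro ⟨a', b', h, ha, hb⟩
      rw [← g.injective ha, ← g.injective hb]
      exact h
    · exact fun h => ⟨a, b, h, rfl, rfl⟩
  · rintro ⟨h₁, h₂⟩
    ext u v
    · rw [← h₁]
      simp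
    · constructor
      · rintro ⟨a, b, h, rfl, rfl⟩
        exact (h₂ a b).2 h
      · intro h
        have hu := C.edge_vert h
        have hv := C.edge_vert h.symm
        rw [← h₁] at hu hv
        obtain ⟨a, rfl⟩ := hu
        obtain ⟨b, rfl⟩ := hv
        exact ⟨a, b, (h₂ a b).1 h, rfl, rfl⟩

end SimpleGraph

section copies

variable {V : Type*} {A : SimpleGraph V} {h n : ℕ}

/-- The words of length `n` with `h` marks. -/
abbrev MarkWord (n h : ℕ) := {w : List Bool // w.length = n ∧ w.count true = h}

/-- The graphs on `Fin h` that are isomorphic to `A`. -/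
abbrev IsoGraph (A : SimpleGraph V) (h : ℕ) := {K : SimpleGraph (Fin h) // Nonempty (A ≃g K)}

/-- The marked vertices of a word, numbered from left to right. -/
noncomputable def MarkWord.equiv (w : MarkWord n h) :
    {u : Fin n // w.1[u]'(w.2.1.symm ▸ u.2) = true} ≃ Fin h :=
  ((finCongr w.2.1.symm).subtypeEquiv fun _ => Iff.rfl).trans (markEquiv w.1 h w.2.2)

theorem MarkWord.equiv_val (w : MarkWord n h) (u) :
    (w.equiv u : ℕ) = (w.1.take u.1).count true := rfl

/-- The copy of `A` on the marked vertices of a word that a graph on `Fin h` describes. -/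
noncomputable def markedCopy (w : MarkWord n h) (K : IsoGraph A h) :
    A.Copy (⊤ : SimpleGraph (Fin n)) where
  toHom := ⟨fun v => (w.equiv.symm (K.2.some v)).1, fun {a b} hab => by
    rw [SimpleGraph.top_adj, Ne, Subtype.val_inj, w.equiv.symm.injective.eq_iff,
      K.2.some.injective.eq_iff]
    exact hab.ne⟩
  injective' := Subtype.val_injective.comp (w.equiv.symm.injective.comp K.2.some.injective)

theorem markedCopy_apply (w : MarkWord n h) (K : IsoGraph A h) (v : V) :
    markedCopy w K v = (w.equiv.symm (K.2.some v)).1 := rfl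

theorem range_markedCopy (w : MarkWord n h) (K : IsoGraph A h) :
    Set.range (markedCopy w K) = {u : Fin n | w.1[u]'(w.2.1.symm ▸ u.2) = true} := by
  ext u
  constructor
  · rintro ⟨v, rfl⟩
    exact (w.equiv.symm (K.2.some v)).2
  · intro hu
    exact ⟨K.2.some.symm (w.equiv ⟨u, hu⟩), by simp [markedCopy_apply]⟩

/-- The copies of `A` in a complete graph correspond to the words of marks together with the graphs
on `Fin h` that are isomorphic to `A`. -/
theorem bijective_markedCopy [Fintype V] (hA : Fintype.card V = h) :
    Function.Bijective fun y : MarkWord n h × IsoGraph A h =>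
      (⟨(markedCopy y.1 y.2).toSubgraph, ⟨(markedCopy y.1 y.2).isoToSubgraph⟩⟩ :
        CopyInComplete A (Fin n)) := by
  constructor
  · rintro ⟨w, K⟩ ⟨w', K'⟩ hy
    have hy : (markedCopy w K).toSubgraph = (markedCopy w' K').toSubgraph :=
      congrArg Subtype.val hy
    have h₁ := (SimpleGraph.Copy.toSubgraph_eq_iff _ _).1 hy
    have h₂ := (SimpleGraph.Copy.toSubgraph_eq_iff (markedCopy w' K') _).1 rfl
    have hr := h₁.1.trans h₂.1.symm
    rw [range_markedCopy, range_markedCopy] at hr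
    have hw : w = w' := by
      apply Subtype.ext
      apply List.ext_getElem (w.2.1.trans w'.2.1.symm)
      intro u hu hu'
      have : _ ↔ _ := Set.ext_iff.1 hr ⟨u, w.2.1 ▸ hu⟩
      exact Bool.eq_iff_iff.2 this
    subst hw
    -- With the word fixed, its numbering of the marked vertices transports the edges of the copy
    -- back to `Fin h` and determines `K`.
    have hK : ∀ (K : IsoGraph A h) (C : (⊤ : SimpleGraph (Fin n)).Subgraph),
        (∀ a b, C.Adj (markedCopy w K a) (markedCopy w K b) ↔ A.Adj a b) → ∀ i j, K.1.Adj i j ↔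
          C.Adj (w.equiv.symm i).1 (w.equiv.symm j).1 := by
      intro K C hC i j
      have := hC (K.2.some.symm i) (K.2.some.symm j)
      simp only [markedCopy_apply, RelIso.apply_symm_apply] at this
      rw [this]
      exact K.2.some.symm.map_adj_iff.symm
    have : K = K' := by
      apply Subtype.ext
      ext i j
      rw [hK K _ h₁.2, hK K' _ h₂.2]
    rw [this]
  · rintro ⟨C, ⟨ψ⟩⟩
    classical
    let w₀ : List Bool := List.ofFn fun u : Fin n => decide (u ∈ C.verts)
    have hlen : w₀.length = n := List.length_ofFn
    have hmem : ∀ u : Fin n, w₀[u]'(hlen.symm ▸ u.2) = true ↔ u ∈ C.verts := by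
      intro u
      simp [w₀]
    have e₀ : {u : Fin w₀.length // w₀[u] = true} ≃ C.verts :=
      (finCongr hlen).subtypeEquiv fun u => hmem (finCongr hlen u)
    have hcount : w₀.count true = h := by
      rw [← hA, ← Fintype.card_fin (w₀.count true)]
      exact Fintype.card_congr ((markEquiv w₀ _ rfl).symm.trans (e₀.trans ψ.toEquiv.symm))
    let w : MarkWord n h := ⟨w₀, hlen, hcount⟩
    let ε : Fin h ≃ C.verts := w.equiv.symm.trans ((Equiv.refl _).subtypeEquiv hmem)
    -- The pullback of `C` along the left-to-right numbering of its vertices. The isomorphism later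
    -- chosen from `K.2` need not be this one; any isomorphism onto `K` gives the same subgraph.
    let K : IsoGraph A h := ⟨C.coe.comap ε, ⟨ψ.trans (SimpleGraph.Iso.comap ε C.coe).symm⟩⟩
    refine ⟨(w, K), Subtype.ext ((SimpleGraph.Copy.toSubgraph_eq_iff _ _).2 ⟨?_, ?_⟩)⟩
    · rw [range_markedCopy]
      ext u
      exact hmem u
    · intro a b
      exact K.2.some.map_adj_iff

end copies

/-! ### The encoding of the graph with attached copies -/

namespace List

variable {α β γ δ : Type*}

/-- The concatenation of the lists `F x p`, where `x` runs through a list and `p` consists of the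
elements before `x`, after the elements of an initial list. -/
def prefixFlatMap (F : α → List α → List β) : List α → List α → List β
  | _, [] => []
  | p, x :: l => F x p ++ prefixFlatMap F (p ++ [x]) l

theorem prefixFlatMap_append (F : α → List α → List β) (p l l' : List α) :
    prefixFlatMap F p (l ++ l') = prefixFlatMap F p l ++ prefixFlatMap F (p ++ l) l' := by
  induction l generalizing p with
  | nil => simp [prefixFlatMap]
  | cons x l ih => simp [prefixFlatMap, ih]

/-- Allows the vertices to be renamed when row contents agree; the fixed prefix `p₀` stands for the
old vertices listed before the new ones. -/
theorem prefixFlatMap_map_congr {F : α → List α → List β} {F' : δ → List δ → List β} (f : γ → α)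
    (g : γ → δ) (p₀ : List α)
    (h : ∀ (x : γ) (ps : List γ), F (f x) (p₀ ++ ps.map f) = F' (g x) (ps.map g)) (l ps : List γ) :
    prefixFlatMap F (p₀ ++ ps.map f) (l.map f) = prefixFlatMap F' (ps.map g) (l.map g) := by
  induction l generalizing ps with
  | nil => rfl
  | cons x l ih =>
    have := ih (ps ++ [x])
    simp only [List.map_append, List.map_cons, List.map_nil] at this
    simp [prefixFlatMap, h, ← this]

theorem filter_lt_finRange {n : ℕ} {x : Fin n} {ys zs : List (Fin n)}
    (h : ys ++ x :: zs = finRange n) : (finRange n).filter (· < x) = ys := by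
  have hs := List.pairwise_lt_finRange n
  rw [← h, List.pairwise_append] at hs
  obtain ⟨-, h₁, h₂⟩ := hs
  rw [← h, List.filter_append, List.filter_eq_self.2, List.filter_eq_nil_iff.2, List.append_nil]
  · intro z hz
    rcases List.mem_cons.1 hz with rfl | hz
    · simp
    · simpa using (List.rel_of_pairwise_cons h₁ hz).le
  · intro y hy
    simpa using h₂ y hy x (by simp)

theorem flatMap_filter_lt_finRange {n : ℕ} (F : Fin n → List (Fin n) → List β) :
    (finRange n).flatMap (fun v => F v ((finRange n).filter (· < v))) =
      prefixFlatMap F [] (finRange n) := by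
  have aux : ∀ zs ys : List (Fin n), ys ++ zs = finRange n →
      zs.flatMap (fun v => F v ((finRange n).filter (· < v))) = prefixFlatMap F ys zs := by
    intro zs
    induction zs with
    | nil => intro ys _; rfl
    | cons x zs ih =>
      intro ys h
      rw [List.flatMap_cons, prefixFlatMap, filter_lt_finRange h, ih (ys ++ [x]) (by simpa using h)]
  exact aux _ [] rfl

end List

open Classical in
/-- The row of a vertex `v` after the vertices of the list `p`. -/
noncomputable def adjRow {W : Type*} (G : SimpleGraph W) (v : W) (p : List W) :
    List (Option Bool) :=
  none :: p.map fun u => some (decide (G.Adj v u))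

theorem ParamGraph.encode_eq (I : ParamGraph) :
    I.encode = AttachMachine.unary I.k ++
      List.prefixFlatMap (adjRow I.graph) [] (List.finRange I.n) := by
  rw [← List.flatMap_filter_lt_finRange]
  rfl

/-! ### The list of new vertices in the order of the machine -/

namespace AttachMachine

variable (D : Params)

/-- The new vertices in the groups of a list. -/
def groupVertices (G : List D.Group) : List (D.Group × Fin D.q) :=
  G.flatMap fun g => (List.finRange D.q).map (Prod.mk g)

open Classical in
/-- The row of a new vertex after the new vertices of the list `p`. -/
noncomputable def vertexRow (y : D.Group × Fin D.q) (p : List (D.Group × Fin D.q)) :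
    List (Option Bool) :=
  none :: (bits (D.old y.1.2.1 y.2) y.1.1 ++
    p.map fun z => decide (y.1 = z.1) && D.new y.2 z.2).map some

open Classical in
-- As the groups are distinct, the comparison of groups in `vertexRow` fails for all earlier groups
-- and yields precisely the zeros written by the machine.
theorem prefixFlatMap_vertexRow {G : List D.Group} (hG : G.Nodup) :
    List.prefixFlatMap (vertexRow D) [] (groupVertices D G) = groupsWord D G := by
  induction G using List.reverseRecOn with
  | nil => rfl
  | append_singleton G g ih =>
    have hg : g ∉ G := fun h => (List.nodup_append.1 hG).2.2 g h g (by simp) rfl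
    have hfalse : ∀ x, ((groupVertices D G).map fun z => decide (g = z.1) && D.new x z.2) =
        List.replicate (D.q * G.length) false := by
      intro x
      rw [List.eq_replicate_iff]
      constructor
      · simp [groupVertices, List.length_flatMap, mul_comm]
      · simp only [groupVertices, List.mem_map, List.mem_flatMap]
        rintro _ ⟨z, ⟨g', hg', y, -, rfl⟩, rfl⟩
        have : g ≠ g' := fun h => hg (h ▸ hg')
        simp [this]
    have aux : ∀ zs ys : List (Fin D.q), ys ++ zs = List.finRange D.q →
        List.prefixFlatMap (vertexRow D) (groupVertices D G ++ ys.map (Prod.mk g))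
          (zs.map (Prod.mk g)) = zs.flatMap (rowWord D g.1 g.2.1 (D.q * G.length)) := by
      intro zs
      induction zs with
      | nil => intro ys _; rfl
      | cons x zs ih =>
        intro ys h
        have h₁ := ih (ys ++ [x]) (by simpa using h)
        rw [List.map_append, ← List.append_assoc] at h₁
        rw [List.map_cons, List.prefixFlatMap, List.flatMap_cons, ← h₁]
        congr 1
        rw [vertexRow, rowWord, List.filter_lt_finRange h, List.map_append (l₁ := groupVertices D G),
          hfalse, List.append_assoc]
        simp [Function.comp_def]
    have h₂ := aux (List.finRange D.q) [] rfl
    rw [List.map_nil, List.append_nil] at h₂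
    rw [groupsWord_concat, groupWord, ← h₂, ← ih (List.nodup_append.1 hG).1]
    simp [groupVertices, List.flatMap_append, List.prefixFlatMap_append]

theorem mem_allGroups {D : Params} {k n : ℕ} {g : D.Group} : g ∈ allGroups D k n ↔
    (g.1.length = n ∧ g.1.count true = D.h) ∧ g.2.1 ∈ D.R ∧ g.2.2 < k + 1 := by
  obtain ⟨w, r, i⟩ := g
  simp only [allGroups, copyGroups, List.mem_flatMap, List.mem_map, List.mem_range, Prod.mk.injEq,
    mem_words]
  constructor
  · rintro ⟨w, hw, r, hr, i, hi, rfl, rfl, rfl⟩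
    exact ⟨hw, hr, hi⟩
  · rintro ⟨hw, hr, hi⟩
    exact ⟨w, hw, r, hr, i, hi, rfl, rfl, rfl⟩

theorem nodup_allGroups (hR : D.R.Nodup) (k n : ℕ) : (allGroups D k n).Nodup := by
  have h₁ (w : List Bool) (r : D.ρ) : (copyGroups D k w r).Nodup :=
    List.nodup_range.map fun i j hij => by simpa using hij
  have h₂ (w : List Bool) : (D.R.flatMap (copyGroups D k w)).Nodup := by
    rw [List.nodup_flatMap]
    refine ⟨fun r _ => h₁ w r, hR.imp fun {r r'} hrr' => ?_⟩
    intro g hg hg'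
    simp only [copyGroups, List.mem_map] at hg hg'
    obtain ⟨i, -, rfl⟩ := hg
    obtain ⟨j, -, hj⟩ := hg'
    simp only [Prod.mk.injEq] at hj
    exact hrr' hj.2.1.symm
  rw [allGroups, List.nodup_flatMap]
  refine ⟨fun w _ => h₂ w, (nodup_words D.h n).imp fun {w w'} hww' => ?_⟩
  intro g hg hg'
  simp only [copyGroups, List.mem_flatMap, List.mem_map] at hg hg'
  obtain ⟨r, -, i, -, rfl⟩ := hg
  obtain ⟨r', -, j, -, hj⟩ := hg'
  simp only [Prod.mk.injEq] at hj
  exact hww' hj.1.symm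

theorem nodup_groupVertices {G : List D.Group} (hG : G.Nodup) : (groupVertices D G).Nodup := by
  rw [groupVertices, List.nodup_flatMap]
  refine ⟨fun g _ => (List.nodup_finRange _).map (Prod.mk_right_injective g),
    hG.imp fun {g g'} hgg' => ?_⟩
  intro y hy hy'
  simp only [List.mem_map] at hy hy'
  obtain ⟨x, -, rfl⟩ := hy
  obtain ⟨x', -, hx'⟩ := hy'
  simp only [Prod.mk.injEq] at hx'
  exact hgg' hx'.1.symm

theorem mem_groupVertices {G : List D.Group} {y : D.Group × Fin D.q} :
    y ∈ groupVertices D G ↔ y.1 ∈ G := by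
  obtain ⟨g, x⟩ := y
  simp [groupVertices]

/-- The new vertices in all groups, when `R` contains all elements. -/
def groupVerticesEquiv (hR : ∀ r, r ∈ D.R) (k n : ℕ) :
    {y // y ∈ groupVertices D (allGroups D k n)} ≃
      (MarkWord n D.h × D.ρ) × Fin (k + 1) × Fin D.q where
  toFun y :=
    have h := mem_allGroups.1 ((mem_groupVertices D).1 y.2)
    ((⟨y.1.1.1, h.1⟩, y.1.1.2.1), ⟨y.1.1.2.2, h.2.2⟩, y.1.2)
  invFun z := ⟨((z.1.1.1, z.1.2, z.2.1), z.2.2),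
    (mem_groupVertices D).2 (mem_allGroups.2 ⟨z.1.1.2, hR _, z.2.1.2⟩)⟩
  left_inv _ := rfl
  right_inv _ := rfl

end AttachMachine

/-! ### The reduction -/

section reduction

variable {V : Type*} [Finite V] (H : SimpleGraph V) (S : Set V)

open AttachMachine

/-- The numbering of the vertices outside `S`. -/
noncomputable def complEquiv : ↥Sᶜ ≃ Fin (Nat.card ↥Sᶜ) := Finite.equivFin _

open Classical in
/-- The data of the machine that attaches copies of `H` at the copies of `H[S]`. -/
noncomputable def attachParams : Params where
  h := Nat.card S
  q := Nat.card ↥Sᶜ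
  ρ := IsoGraph (H.induce S) (Nat.card S)
  R := Finset.univ.toList
  old K x := List.ofFn fun j => decide (H.Adj (K.2.some.symm j) ((complEquiv S).symm x))
  new x y := decide (H.Adj ((complEquiv S).symm x) ((complEquiv S).symm y))
  length_old _ _ := List.length_ofFn

/-- The copies of `H[S]` correspond to the words of marks together with the graphs on `Fin h` that
are isomorphic to `H[S]`. -/
noncomputable def markedCopyEquiv (n : ℕ) :
    MarkWord n (Nat.card S) × IsoGraph (H.induce S) (Nat.card S) ≃
      CopyInComplete (H.induce S) (Fin n) :=
  letI := Fintype.ofFinite S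
  Equiv.ofBijective _ (bijective_markedCopy (A := H.induce S) Nat.card_eq_fintype_card.symm)

/-- Provides the `φ` of the theorem: the identification of `H[S]` with `C` that the machine's rows
implicitly use. -/
theorem exists_iso_markedCopy (n : ℕ) (C : CopyInComplete (H.induce S) (Fin n)) :
    ∃ ψ : H.induce S ≃g C.1.coe, ∀ y, (ψ y : Fin n) =
      markedCopy ((markedCopyEquiv H S n).symm C).1 ((markedCopyEquiv H S n).symm C).2 y := by
  obtain ⟨y, rfl⟩ := (markedCopyEquiv H S n).surjective C
  rw [Equiv.symm_apply_apply]
  exact ⟨(markedCopy y.1 y.2).isoToSubgraph, fun _ => rfl⟩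

open Classical in
theorem attachParams_old_getD (K : IsoGraph (H.induce S) (Nat.card S)) (x : Fin (Nat.card ↥Sᶜ))
    {j : ℕ} (hj : j < Nat.card S) : ((attachParams H S).old K x).getD j false =
      decide (H.Adj (K.2.some.symm ⟨j, hj⟩) ((complEquiv S).symm x)) := by
  simp only [attachParams, List.getD_eq_getElem?_getD, List.getElem?_ofFn, dif_pos hj,
    Option.getD_some]

open Classical in
/-- The adjacencies between a new vertex and the base graph are the bits written by the machine. -/
theorem bits_attachParams {n : ℕ} (w : MarkWord n (Nat.card S))
    (K : IsoGraph (H.induce S) (Nat.card S)) (x : Fin (Nat.card ↥Sᶜ)) :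
    bits ((attachParams H S).old K x) w.1 = (List.finRange n).map fun u =>
      decide (∃ y : S, markedCopy w K y = u ∧ H.Adj y ((complEquiv S).symm x)) := by
  apply List.ext_getElem
  · simp [w.2.1]
  intro u hu hu'
  have hu₁ : u < n := by simpa using hu'
  have hu₂ : u < w.1.length := by simpa using hu
  rw [AttachMachine.getElem_bits _ _ _ hu₂, List.getElem_map, List.getElem_finRange, Bool.eq_iff_iff,
    Bool.and_eq_true, decide_eq_true_iff]
  have hrange : (∃ y, markedCopy w K y = ⟨u, hu₁⟩) ↔ w.1[u] = true :=
    Set.ext_iff.1 (range_markedCopy w K) ⟨u, hu₁⟩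
  by_cases h₁ : w.1[u] = true
  -- A marked position `u` has the number of marks before it as its index in `Fin h`, which names
  -- the only vertex of `S` placed at `u`.
  · let m : {u : Fin n // w.1[u]'(w.2.1.symm ▸ u.2) = true} := ⟨⟨u, hu₁⟩, h₁⟩
    have h₂ : (w.1.take u).count true < Nat.card S := (w.equiv m).2
    have h₃ : markedCopy w K (K.2.some.symm ⟨(w.1.take u).count true, h₂⟩) = ⟨u, hu₁⟩ := by
      have h₄ : w.equiv m = ⟨(w.1.take u).count true, h₂⟩ := Fin.ext (w.equiv_val m)
      rw [markedCopy_apply, RelIso.apply_symm_apply, ← h₄, Equiv.symm_apply_apply]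
    rw [attachParams_old_getD H S K x h₂, decide_eq_true_iff]
    constructor
    · exact fun h => ⟨_, h₃, h.2⟩
    · rintro ⟨y, hy, hadj⟩
      rw [(markedCopy w K).injective (h₃.trans hy.symm)]
      exact ⟨h₁, hadj⟩
  · exact ⟨fun h => absurd h.1 h₁, fun ⟨y, hy, _⟩ => absurd (hrange.1 ⟨y, hy⟩) h₁⟩

theorem mem_attachParams_R (r : (attachParams H S).ρ) : r ∈ (attachParams H S).R := by
  classical
  exact Finset.mem_toList.2 (Finset.mem_univ (α := IsoGraph (H.induce S) (Nat.card S)) r)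

theorem nodup_attachParams_R : (attachParams H S).R.Nodup := by
  classical
  exact Finset.nodup_toList (Finset.univ (α := IsoGraph (H.induce S) (Nat.card S)))

/-- The new vertices in the machine's output are those of the graph with attached copies. -/
noncomputable def newVertexEquiv (n k : ℕ) :
    {y // y ∈ groupVertices (attachParams H S) (allGroups (attachParams H S) k n)} ≃
      CopyInComplete (H.induce S) (Fin n) × Fin (k + 1) × ↥Sᶜ :=
  (groupVerticesEquiv (attachParams H S) (mem_attachParams_R H S) k n).trans
    (Equiv.prodCongr (markedCopyEquiv H S n)
      (Equiv.prodCongr (Equiv.refl _) (complEquiv S).symm))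

section

variable {H S} {n k : ℕ} {G' : SimpleGraph (Fin n)}
  {φ : ∀ C : CopyInComplete (H.induce S) (Fin n), H.induce S ≃g C.1.coe}

theorem attachCopies_adj_newVertexEquiv_inl
    (hφ : ∀ C y, (φ C y : Fin n) =
      markedCopy ((markedCopyEquiv H S n).symm C).1 ((markedCopyEquiv H S n).symm C).2 y)
    (y : {y // y ∈ groupVertices (attachParams H S) (allGroups (attachParams H S) k n)})
    (w : MarkWord n (Nat.card S)) (hw : w.1 = y.1.1.1) (u : Fin n) :
    (attachCopies H S (k + 1) G' φ).Adj (.inr (newVertexEquiv H S n k y)) (.inl u) ↔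
      ∃ z : S, markedCopy w (y.1.1.2.1 : IsoGraph (H.induce S) (Nat.card S)) z = u ∧
        H.Adj z ((complEquiv S).symm y.1.2) := by
  let f := groupVerticesEquiv (attachParams H S) (mem_attachParams_R H S) k n y
  let g : MarkWord n (Nat.card S) × IsoGraph (H.induce S) (Nat.card S) := f.1
  have h₁ : newVertexEquiv H S n k y =
    (markedCopyEquiv H S n g, f.2.1, (complEquiv S).symm y.1.2) := rfl
  have h₂ : w = g.1 := Subtype.ext hw
  rw [h₁, h₂]
  change (∃ z : S, (φ (markedCopyEquiv H S n g) z : Fin n) = u ∧ _) ↔ _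
  simp only [hφ, Equiv.symm_apply_apply]
  rfl

theorem attachCopies_adj_newVertexEquiv_inr
    (y z : {y // y ∈ groupVertices (attachParams H S) (allGroups (attachParams H S) k n)}) :
    (attachCopies H S (k + 1) G' φ).Adj (.inr (newVertexEquiv H S n k y))
        (.inr (newVertexEquiv H S n k z)) ↔
      y.1.1 = z.1.1 ∧ H.Adj ((complEquiv S).symm y.1.2) ((complEquiv S).symm z.1.2) := by
  let f := groupVerticesEquiv (attachParams H S) (mem_attachParams_R H S) k n
  let g (y) : MarkWord n (Nat.card S) × IsoGraph (H.induce S) (Nat.card S) := (f y).1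
  have h₁ (y) : newVertexEquiv H S n k y =
    (markedCopyEquiv H S n (g y), (f y).2.1, (complEquiv S).symm y.1.2) := rfl
  rw [h₁, h₁]
  change _ = _ ∧ _ = _ ∧ _ ↔ _
  rw [(markedCopyEquiv H S n).injective.eq_iff, ← and_assoc]
  refine and_congr_left' ⟨fun ⟨h₂, h₃⟩ => ?_, fun h => ?_⟩
  · have h₄ : y.1.1.1 = z.1.1.1 := congrArg (fun g => g.1.1) h₂
    have h₅ : y.1.1.2.1 = z.1.1.2.1 := congrArg (fun g => g.2) h₂
    have h₆ : y.1.1.2.2 = z.1.1.2.2 := congrArg Fin.val h₃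
    exact Prod.ext h₄ (Prod.ext h₅ h₆)
  · refine ⟨Prod.ext (Subtype.ext ?_) ?_, Fin.ext ?_⟩
    · exact congrArg (fun g => g.1) h
    · exact congrArg (fun g => g.2.1) h
    · exact congrArg (fun g => g.2.2) h

open Classical in
theorem adjRow_newVertexEquiv
    (hφ : ∀ C y, (φ C y : Fin n) =
      markedCopy ((markedCopyEquiv H S n).symm C).1 ((markedCopyEquiv H S n).symm C).2 y)
    (y : {y // y ∈ groupVertices (attachParams H S) (allGroups (attachParams H S) k n)})
    (l : List {y // y ∈ groupVertices (attachParams H S) (allGroups (attachParams H S) k n)}) :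
    adjRow (attachCopies H S (k + 1) G' φ) (.inr (newVertexEquiv H S n k y))
        ((List.finRange n).map .inl ++ l.map fun z => .inr (newVertexEquiv H S n k z)) =
      vertexRow (attachParams H S) y.1 (l.map Subtype.val) := by
  have hw := (mem_allGroups.1 ((mem_groupVertices _).1 y.2)).1
  have hb := bits_attachParams H S ⟨y.1.1.1, hw⟩ y.1.1.2.1 y.1.2
  rw [adjRow, vertexRow, hb]
  congr 1
  rw [List.map_append, List.map_append]
  congr 1
  · rw [List.map_map, List.map_map]
    apply List.map_congr_left
    intro u _
    simp only [Function.comp_apply, Option.some_inj, decide_eq_decide]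
    exact attachCopies_adj_newVertexEquiv_inl hφ y ⟨y.1.1.1, hw⟩ rfl u
  · rw [List.map_map, List.map_map, List.map_map]
    apply List.map_congr_left
    intro z _
    simp only [Function.comp_apply, Option.some_inj, attachCopies_adj_newVertexEquiv_inr,
      Bool.decide_and]
    rfl

end

/-- Numbering the new vertices after the old ones, in the order of `groupVertices`, leaves the old
rows unchanged, since a row only lists earlier vertices. -/
theorem exists_instance (I : ParamGraph) :
    ∃ (φ : ∀ C : CopyInComplete (H.induce S) (Fin I.n), H.induce S ≃g C.1.coe) (J : ParamGraph),
      J.k = I.k ∧ Nonempty (J.graph ≃g attachCopies H S (I.k + 1) I.graph φ) ∧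
      J.encode = I.encode ++
        groupsWord (attachParams H S) (allGroups (attachParams H S) I.k I.n) := by
  classical
  choose φ hφ using exists_iso_markedCopy H S I.n
  have hnd := nodup_allGroups _ (nodup_attachParams_R H S) I.k I.n
  let L := groupVertices (attachParams H S) (allGroups (attachParams H S) I.k I.n)
  have hL : L.Nodup := nodup_groupVertices _ hnd
  let e : Fin (I.n + L.length) ≃ Fin I.n ⊕ (CopyInComplete (H.induce S) (Fin I.n) ×
      Fin (I.k + 1) × ↥Sᶜ) :=
    finSumFinEquiv.symm.trans (Equiv.sumCongr (Equiv.refl _)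
      ((List.Nodup.getEquiv L hL).trans (newVertexEquiv H S I.n I.k)))
  let A := attachCopies H S (I.k + 1) I.graph φ
  refine ⟨φ, ⟨I.n + L.length, A.comap e, I.k⟩, rfl, ⟨SimpleGraph.Iso.comap e A⟩, ?_⟩
  have h₁ : (List.finRange (I.n + L.length)).map e = (List.finRange I.n).map Sum.inl ++
      L.attach.map fun y => Sum.inr (newVertexEquiv H S I.n I.k y) := by
    rw [← List.ofFn_eq_map, List.ofFn_add]
    congr 1
    · rw [← List.ofFn_eq_map]
      congr 1
      funext u
      change e (Fin.castAdd _ u) = _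
      simp [e]
    · apply List.ext_getElem
      · simp
      · intro j hj hj'
        simp only [List.getElem_ofFn, List.getElem_map, e, Equiv.trans_apply,
          finSumFinEquiv_symm_apply_natAdd, Equiv.sumCongr_apply, Sum.map_inr]
        rw [List.getElem_attach]
        rfl
  have h₂ : List.prefixFlatMap (adjRow (A.comap e)) [] (List.finRange (I.n + L.length)) =
      List.prefixFlatMap (adjRow A) [] ((List.finRange (I.n + L.length)).map e) := by
    have := List.prefixFlatMap_map_congr (F := adjRow (A.comap e)) (F' := adjRow A) id e []
      (fun x ps => by simp [adjRow]) (List.finRange (I.n + L.length)) []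
    simpa using this
  have h₃ : List.prefixFlatMap (adjRow A) [] ((List.finRange I.n).map Sum.inl) =
      List.prefixFlatMap (adjRow I.graph) [] (List.finRange I.n) := by
    have := List.prefixFlatMap_map_congr (F := adjRow A) (F' := adjRow I.graph) Sum.inl id []
      (fun x ps => by
        simp only [adjRow, List.nil_append, List.map_map, List.map_id]
        rfl) (List.finRange I.n) []
    simpa using this
  have h₄ : List.prefixFlatMap (adjRow A) ((List.finRange I.n).map Sum.inl)
      (L.attach.map fun y => Sum.inr (newVertexEquiv H S I.n I.k y)) =
        List.prefixFlatMap (vertexRow (attachParams H S)) [] L := by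
    have := List.prefixFlatMap_map_congr (F := adjRow A) (F' := vertexRow (attachParams H S))
      (fun y : {y // y ∈ L} => Sum.inr (newVertexEquiv H S I.n I.k y)) Subtype.val
      ((List.finRange I.n).map Sum.inl) (adjRow_newVertexEquiv hφ) L.attach []
    rw [List.attach_map_subtype_val] at this
    simpa using this
  rw [ParamGraph.encode_eq, ParamGraph.encode_eq I]
  change unary I.k ++ List.prefixFlatMap (adjRow (A.comap e)) [] (List.finRange (I.n + L.length)) = _
  rw [h₂, h₁, List.prefixFlatMap_append, h₃, List.nil_append, h₄,
    prefixFlatMap_vertexRow _ hnd, List.append_assoc]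

end reduction

theorem mainTheorem7 {V : Type*} [Fintype V] (H : SimpleGraph V) [DecidableRel H.Adj] (d : ℤ)
    (V' : Set V) (hV' : V' = {v | d < (H.degree v : ℤ)}) (kind : ModificationKind) :
    ∃ f : ParamGraph → ParamGraph,
      IsLinearParameterizedReduction
        (FreeEdgeModification (H.induce V') kind) (FreeEdgeModification H kind) f ∧
      ∀ I : ParamGraph,
        ∃ φ : ∀ C : CopyInComplete (H.induce V') (Fin I.n), H.induce V' ≃g C.1.coe,
          Nonempty ((f I).graph ≃g attachCopies H V' (I.k + 1) I.graph φ) := by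
  choose φ f hk he hf using exists_instance H V'
  refine ⟨f, ⟨AttachMachine.nonempty_computableInPolyTime _ f hf, fun I => ?_, 1, fun I => ?_⟩,
    fun I => ⟨φ I, he I⟩⟩
  · change CanModify (H.induce V') kind I.graph I.k ↔ CanModify H kind (f I).graph (f I).k
    rw [hk, CanModify.iso_iff (he I).some]
    exact ⟨.attachCopies hV', .of_attachCopies⟩
  · rw [hk, one_mul]
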